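/- Let $\gamma=(1+\sqrt5)/2$ and $J=\begin{pmatrix}0&1\\-1&0\end{pmatrix}$. Identify a point $\mathbf y=(y_0,y_1,y_2)\in\mathbb Z^3$ with the symmetric matrix $\begin{pmatrix}y_0&y_1\\y_1&y_2\end{pmatrix}$, put $\|\mathbf y\|=\max\{|y_0|,|y_1|,|y_2|\}$ and $[\mathbf x,\mathbf x,\mathbf z]=-\mathbf xJ\mathbf zJ\mathbf x$. Let $\{x\}$ denote the distance from a real number $x$ to a nearest integer, and let $H(\alpha)$ denote the height of an algebraic number $\alpha$, i.e. the maximum of the absolute values of the coefficients of its irreducible polynomial over $\mathbb Z$. **Corollary 10.2.** Let $A,B$ be non-commuting symmetric matrices in $\mathrm{GL}_2(\mathbb Z)$ such that all coefficients of $A$ are non-negative and all coefficients of $AB$ are positive. Define $\mathbf y_{-1}=B^{-1}$, $\mathbf y_0=I$, $\mathbf y_1=A$, $\mathbf y_k=[\mathbf y_{k-1},\mathbf y_{k-1},\mathbf y_{k-3}]$ for $k\ge2$, and write $\mathbf y_k=(y_{k,0},y_{k,1},y_{k,2})$, $Y_k=\|\mathbf y_k\|$. Assume moreover that $\mathrm{trace}(JAB)=\pm1$.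 Then the limit $\xi=\lim_{k\to\infty}y_{k,1}/y_{k,0}$ exists, and the following conditions are equivalent: (i) There exists $\theta>\gamma^2$ such that the inequality $|\xi-\alpha|\le H(\alpha)^{-\theta}$ has infinitely many solutions in algebraic integers $\alpha\in\mathbb C$ of degree $\le3$ over $\mathbb Q$. (ii) There exists $\delta>0$ such that the inequality $\{y_{k,0}\xi^3\}\le Y_k^{-\delta}$ holds for infinitely many indices $k$. In particular, let $a,b$ be positive integers with $|a-b|=1$, and let $\xi_{a,b}=[0,a,b,a,a,b,\dots]$ be the continued fraction whose partial quotients are $0$ followed by the letters of the infinite Fibonacci word on $\{a,b\}$, the limit of the words $w_0=b$, $w_1=a$, $w_i=w_{i-1}w_{i-2}$ $(i\ge2)$. Then $A=\begin{pmatrix}a&1\\1&0\end{pmatrix}$ and $B=\begin{pmatrix}b&1\\1&0\end{pmatrix}$ satisfy all the above hypotheses, the corresponding limit $\xi$ is $\xi_{a,b}$, and (i) and (ii) are equivalent for it. -/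

import Mathlib

open Filter Topology

namespace Roy

/-- The matrix `J = (0 1; -1 0)`. -/
def J : Matrix (Fin 2) (Fin 2) ℤ := !![0, 1; -1, 0]

/-- The bracket `[x, y, z] = -x J z J y`. A triple `(x₀, x₁, x₂) ∈ ℤ³` is identified with the
symmetric matrix `(x₀ x₁; x₁ x₂)`, so its coordinates are the entries `x 0 0`, `x 0 1`, `x 1 1`. -/
def bracket (x y z : Matrix (Fin 2) (Fin 2) ℤ) : Matrix (Fin 2) (Fin 2) ℤ :=
  -(x * J * z * J * y)

/-- The sequence of points attached to `A` and `B`, with its index shifted by one so that it starts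
at `0`: `shifted A B n` is `y_{n-1}`, where `y_{-1} = B⁻¹`, `y_0 = I`, `y_1 = A` and
`y_k = [y_{k-1}, y_{k-1}, y_{k-3}]` for `k ≥ 2`. -/
noncomputable def shifted (A B : Matrix (Fin 2) (Fin 2) ℤ) : ℕ → Matrix (Fin 2) (Fin 2) ℤ
  | 0 => B⁻¹
  | 1 => 1
  | 2 => A
  | n + 3 => bracket (shifted A B (n + 2)) (shifted A B (n + 2)) (shifted A B n)

/-- The point `y_k`, for `k ≥ 0`. -/
noncomputable def point (A B : Matrix (Fin 2) (Fin 2) ℤ) (k : ℕ) : Matrix (Fin 2) (Fin 2) ℤ :=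
  shifted A B (k + 1)

/-- For symmetric `A` and `B` every `y_k` is symmetric, hence a point of `ℤ³`. -/
theorem shifted_isSymm {A B : Matrix (Fin 2) (Fin 2) ℤ} (hA : A.IsSymm) (hB : B.IsSymm) (n : ℕ) :
    (shifted A B n).IsSymm := by
  induction n using Nat.strong_induction_on with
  | _ n ih =>
    match n, ih with
    | 0, _ =>
      show (B⁻¹).transpose = B⁻¹
      rw [Matrix.transpose_nonsing_inv, hB.eq]
    | 1, _ => exact Matrix.isSymm_one
    | 2, _ => exact hA
    | n + 3, ih =>
      have h0 : (shifted A B n).transpose = shifted A B n := ih n (by omega)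
      have h2 : (shifted A B (n + 2)).transpose = shifted A B (n + 2) := ih (n + 2) (by omega)
      have hJ : J.transpose = -J := by
        ext i j; fin_cases i <;> fin_cases j <;> simp [J]
      show (bracket _ _ _).transpose = bracket _ _ _
      simp [bracket, Matrix.transpose_mul, h0, h2, hJ, Matrix.mul_assoc]

/-- The norm `‖y‖ = max {|y₀|, |y₁|, |y₂|}` of a point. -/
def norm (y : Matrix (Fin 2) (Fin 2) ℤ) : ℤ :=
  max |y 0 0| (max |y 0 1| |y 1 1|)

/-- `A` and `B` are non-commuting symmetric matrices in `GL₂(ℤ)`, the coefficients of `A` are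
non-negative and those of `AB` are positive. -/
structure Admissible (A B : Matrix (Fin 2) (Fin 2) ℤ) : Prop where
  symm_left : A.IsSymm
  symm_right : B.IsSymm
  unit_left : IsUnit A.det
  unit_right : IsUnit B.det
  not_comm : A * B ≠ B * A
  nonneg : ∀ i j, 0 ≤ A i j
  pos : ∀ i j, 0 < (A * B) i j

/-- `ξ = lim y_{k,1} / y_{k,0}`. -/
def IsLimit (A B : Matrix (Fin 2) (Fin 2) ℤ) (ξ : ℝ) : Prop :=
  Tendsto (fun k : ℕ => (point A B k 0 1 : ℝ) / (point A B k 0 0 : ℝ)) atTop (𝓝 ξ)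

/-- The distance `{x}` from `x` to a nearest integer. -/
noncomputable def distInt (x : ℝ) : ℝ := |x - round x|

theorem distInt_isLeast (x : ℝ) : IsLeast (Set.range fun p : ℤ => |x - p|) (distInt x) :=
  ⟨⟨round x, rfl⟩, by rintro _ ⟨p, rfl⟩; exact round_le x p⟩

/-- The height of an integer polynomial: the maximum of the absolute values of its coefficients. -/
def polyHeight (P : Polynomial ℤ) : ℕ := P.support.sup fun i => (P.coeff i).natAbs

/-- The height of an algebraic integer `α`, that is, of its irreducible polynomial over `ℤ`
(which is the monic polynomial `minpoly ℤ α`). -/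
noncomputable def height (α : ℂ) : ℕ := polyHeight (minpoly ℤ α)

/-- For some `θ > γ²`, where `γ` is the golden ratio, `|ξ - α| ≤ H(α)^{-θ}` for infinitely many
algebraic integers `α ∈ ℂ` of degree at most `3` over `ℚ`. -/
def CubicApprox (ξ : ℝ) : Prop :=
  ∃ θ : ℝ, Real.goldenRatio ^ 2 < θ ∧
    {α : ℂ | IsIntegral ℤ α ∧ (minpoly ℚ α).natDegree ≤ 3 ∧
      ‖(ξ : ℂ) - α‖ ≤ (height α : ℝ) ^ (-θ)}.Infinite

/-- For some `δ > 0`, `{y_{k,0} ξ³} ≤ Y_k^{-δ}` for infinitely many `k`, where `Y_k = ‖y_k‖`. -/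
def SmallCube (A B : Matrix (Fin 2) (Fin 2) ℤ) (ξ : ℝ) : Prop :=
  ∃ δ : ℝ, 0 < δ ∧
    {k : ℕ | distInt ((point A B k 0 0 : ℝ) * ξ ^ 3) ≤ (norm (point A B k) : ℝ) ^ (-δ)}.Infinite

/-- The finite Fibonacci words `w₀ = b`, `w₁ = a`, `w_i = w_{i-1} w_{i-2}`. -/
def fibWord (a b : ℕ) : ℕ → List ℕ
  | 0 => [b]
  | 1 => [a]
  | n + 2 => fibWord a b (n + 1) ++ fibWord a b n

/-- The `n`-th letter, counted from `0`, of the infinite Fibonacci word `abaab…` on `{a, b}`.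
It is read off `w_{n+2}`, which is a prefix of the infinite word with more than `n` letters, so the
default value is never used. -/
def fibLetter (a b n : ℕ) : ℕ := (fibWord a b (n + 2)).getD n 0

/-- The continued fraction `[0, a, b, a, a, b, …]`. -/
noncomputable def fibContFract (a b : ℕ) : GenContFract ℝ where
  h := 0
  s := Stream'.Seq.ofStream fun n => ⟨1, (fibLetter a b n : ℝ)⟩

end Roy

/-!
Up to sign, the points `y_k` are the palindromic prefixes `1, A, ABA, ABAABA, …` of the infinite
Fibonacci word on the letters `A, B` (`Roy.pal`, `Roy.exists_sign`). These are non-negative matrices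
of determinant `±1`, and from `ABA` on they all begin with the positive matrix `ABA`, so their
entries are comparable. Hence the slopes `y_{k,1} / y_{k,0}` form a Cauchy sequence, with limit `ξ`,
and, writing `u k = |y_{k,0}|`, the point `y_k` is at distance `O(1 / u k)` from
`± u k • (1, ξ, ξ²)`, while `u (k + 2) ≍ u (k + 1) u k`. The condition `trace(JAB) = ±1` says that
`y_{-1}, y_0, y_1` form a basis of `ℤ³`, a property which the recurrence passes on to any three
consecutive points. All of this is recorded in the structure `Roy.ApproxSeq`, to which the
equivalence of (i) and (ii) is reduced. In particular `u (k + 1) ≍ (u k) ^ φ`, where `φ` is the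
golden ratio (`Roy.ApproxSeq.exists_growth`).

*From (i) to (ii)* (`Roy.ApproxSeq.frequently_distInt_le`). An algebraic integer `α` of height `H`
with `|ξ - α| ≤ H ^ (-φ² - ε)` is a root of a monic integer cubic `P` of height `H`, and
`|P(ξ)| ≪ H ^ (-φ - ε)`. Pairing the coefficients of `P` with `y_k` gives
`{u k ξ³} ≪ u k |P(ξ)| + H / u k`, and the growth of `u` provides an index `k` for which both terms
are at most a negative power of `u k`.

*From (ii) to (i)* (`Roy.ApproxSeq.cubicApprox`). Solving a linear system with the unimodular matrix
of rows `y_k, y_{k+1}, y_{k+2}` and with right-hand sides close to `-u j ξ³` produces a monic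
integer cubic `P` of height `O(u (k + 1))` for which `P(ξ)` is tiny, provided that
`{u (k + 2) ξ³}` is small. The right-hand side at `k + 1` may be rounded in two ways, and one of
them makes `|P'(ξ)| ≫ u (k + 1)` (`Roy.ApproxSeq.exists_cubic_small`). The root of `P` nearest to
`ξ` is then a good approximation, and its height is controlled by Mignotte's bound. That infinitely
many different roots arise follows from the linear independence of `1, ξ, ξ²` over `ℚ`.

For `A = (a 1; 1 0)` and `B = (b 1; 1 0)` the products over initial segments of the Fibonacci word
are the continuant matrices of the continued fraction. They begin with longer and longer `pal k`, so
the convergents have the same limit `ξ` (`Roy.tendsto_convs`).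
-/

namespace Roy

/-! ### Monic integer cubics and heights -/

open Polynomial in
theorem aeval_monicCubic (p q r : ℤ) (α : ℂ) :
    aeval α (⟨1, p, q, r⟩ : Cubic ℤ).toPoly = α ^ 3 + p * α ^ 2 + q * α + r := by
  simp [Cubic.toPoly]

theorem natAbs_coeff_le_polyHeight (P : Polynomial ℤ) (i : ℕ) :
    (P.coeff i).natAbs ≤ polyHeight P := by
  by_cases h : i ∈ P.support
  · exact Finset.le_sup (f := fun i => (P.coeff i).natAbs) h
  · simp [Polynomial.notMem_support_iff.mp h]

theorem one_le_height {α : ℂ} (hα : IsIntegral ℤ α) : 1 ≤ height α := by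
  have h := natAbs_coeff_le_polyHeight (minpoly ℤ α) (minpoly ℤ α).natDegree
  rw [(minpoly.monic hα).coeff_natDegree] at h
  exact h

theorem natDegree_minpoly_rat {α : ℂ} (hα : IsIntegral ℤ α) :
    (minpoly ℚ α).natDegree = (minpoly ℤ α).natDegree := by
  rw [minpoly.isIntegrallyClosed_eq_field_fractions' ℚ hα,
    (minpoly.monic hα).natDegree_map]

open Polynomial in
/-- A root of a monic integer cubic with coefficients at most `H` is an algebraic integer of height
at most `12 H`: this is Mignotte's bound for the factor `minpoly ℤ α` of the cubic. -/
theorem height_le_of_root {p q r : ℤ} {H : ℝ} (hH : 1 ≤ H) (hp : |(p : ℝ)| ≤ H)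
    (hq : |(q : ℝ)| ≤ H) (hr : |(r : ℝ)| ≤ H) {α : ℂ}
    (hα : α ^ 3 + p * α ^ 2 + q * α + r = 0) :
    IsIntegral ℤ α ∧ (minpoly ℚ α).natDegree ≤ 3 ∧ (height α : ℝ) ≤ 12 * H := by
  set P : ℤ[X] := (⟨1, p, q, r⟩ : Cubic ℤ).toPoly with hP
  have hmonic : P.Monic := Cubic.monic_of_a_eq_one'
  have hdeg : P.natDegree = 3 := Cubic.natDegree_of_a_ne_zero' one_ne_zero
  have hroot : aeval α P = 0 := by rw [hP, aeval_monicCubic, hα]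
  have hint : IsIntegral ℤ α := ⟨P, hmonic, hroot⟩
  have hdvd : minpoly ℤ α ∣ P := minpoly.isIntegrallyClosed_dvd hint hroot
  have hle : (minpoly ℤ α).natDegree ≤ 3 := hdeg ▸ natDegree_le_of_dvd hdvd hmonic.ne_zero
  refine ⟨hint, (natDegree_minpoly_rat hint).trans_le hle, ?_⟩
  obtain ⟨R, hR⟩ := hdvd
  have hR0 : R ≠ 0 := by
    rintro rfl
    exact hmonic.ne_zero (by simpa using hR)
  have hPmap : P.map (Int.castRingHom ℂ) = (⟨1, p, q, r⟩ : Cubic ℂ).toPoly := by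
    simp [hP, Cubic.toPoly]
  have hM : (P.map (Int.castRingHom ℂ)).mahlerMeasure ≤ 4 * H := by
    refine (mahlerMeasure_le_sum_norm_coeff _).trans ?_
    rw [sum_over_range _ (by simp), natDegree_map_eq_of_injective (Int.castRingHom ℂ).injective_int,
      hdeg, hPmap]
    simp only [Finset.sum_range_succ, Finset.range_zero, Finset.sum_empty, Cubic.coeff_eq_a,
      Cubic.coeff_eq_b, Cubic.coeff_eq_c, Cubic.coeff_eq_d, Complex.norm_intCast, norm_one]
    linarith
  have hcoeff : ∀ i, (((minpoly ℤ α).coeff i).natAbs : ℝ) ≤ 12 * H := by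
    intro i
    have h1 := norm_coeff_le_choose_mul_mahlerMeasure_of_one_le_mahlerMeasure i
      ((minpoly ℤ α).map (Int.castRingHom ℂ)) (R.map (Int.castRingHom ℂ))
      (one_le_mahlerMeasure_of_ne_zero hR0)
    rw [← Polynomial.map_mul, ← hR, natDegree_map_eq_of_injective
      (Int.castRingHom ℂ).injective_int, coeff_map, eq_intCast, Complex.norm_intCast] at h1
    have h2 : (minpoly ℤ α).natDegree.choose i ≤ 3 := by
      refine (Nat.choose_le_choose i hle).trans ?_
      match i with
      | 0 | 1 | 2 | 3 => decide
      | i + 4 => simp [Nat.choose_eq_zero_of_lt]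
    have h3 : ((minpoly ℤ α).natDegree.choose i : ℝ) ≤ 3 := by exact_mod_cast h2
    rw [Nat.cast_natAbs, Int.cast_abs]
    calc _ ≤ _ := h1
      _ ≤ 3 * (4 * H) := by gcongr; exact mahlerMeasure_nonneg _
      _ = _ := by ring
  have hsup : height α ≤ ⌊12 * H⌋₊ :=
    Finset.sup_le fun i _ => Nat.le_floor (hcoeff i)
  exact (Nat.cast_le.mpr hsup).trans (Nat.floor_le (by linarith))

open Polynomial in
/-- A monic cubic `P` has a complex root `α` with `|ξ - α| |P'(ξ)| ≤ 3 |P(ξ)|`: take the root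
nearest to `ξ` in `P'(ξ) = P(ξ) ∑ 1 / (ξ - α_i)`. -/
theorem exists_root_near (p q r : ℤ) (ξ : ℝ) :
    ∃ α : ℂ, α ^ 3 + p * α ^ 2 + q * α + r = 0 ∧
      ‖(ξ : ℂ) - α‖ * |3 * ξ ^ 2 + 2 * p * ξ + q| ≤ 3 * |ξ ^ 3 + p * ξ ^ 2 + q * ξ + r| := by
  set P : Cubic ℤ := ⟨1, p, q, r⟩ with hP
  have ha : (1 : ℤ) ≠ 0 := one_ne_zero
  set φ := Int.castRingHom ℂ with hφ
  have hPa : (P.map φ).a ≠ 0 := by simp [hP, Cubic.map]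
  obtain ⟨x, y, z, h3⟩ :=
    (Cubic.splits_iff_roots_eq_three (P := P.map φ) (φ := RingHom.id ℂ) hPa).mp
      (IsAlgClosed.splits _)
  have hb := Cubic.b_eq_three_roots hPa h3
  have hc := Cubic.c_eq_three_roots hPa h3
  have hd := Cubic.d_eq_three_roots hPa h3
  simp only [hP, Cubic.map, RingHom.id_apply, hφ, eq_intCast, Int.cast_one, one_mul] at hb hc hd
  have hval : ((ξ ^ 3 + p * ξ ^ 2 + q * ξ + r : ℝ) : ℂ) = (ξ - x) * (ξ - y) * (ξ - z) := by
    push_cast; rw [hb, hc, hd]; ring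
  have hder : ((3 * ξ ^ 2 + 2 * p * ξ + q : ℝ) : ℂ) =
      (ξ - y) * (ξ - z) + (ξ - x) * (ξ - z) + (ξ - x) * (ξ - y) := by
    push_cast; rw [hb, hc]; ring
  have hval' : |ξ ^ 3 + p * ξ ^ 2 + q * ξ + r| = ‖(ξ : ℂ) - x‖ * ‖(ξ : ℂ) - y‖ * ‖(ξ : ℂ) - z‖ := by
    rw [← norm_mul, ← norm_mul, ← hval, Complex.norm_real, Real.norm_eq_abs]
  have hder' : |3 * ξ ^ 2 + 2 * p * ξ + q| ≤ ‖(ξ : ℂ) - y‖ * ‖(ξ : ℂ) - z‖ +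
      ‖(ξ : ℂ) - x‖ * ‖(ξ : ℂ) - z‖ + ‖(ξ : ℂ) - x‖ * ‖(ξ : ℂ) - y‖ := by
    rw [← norm_mul, ← norm_mul, ← norm_mul, ← Real.norm_eq_abs, ← Complex.norm_real, hder]
    exact norm_add₃_le
  rw [hval']
  have hx0 := norm_nonneg ((ξ : ℂ) - x)
  have hy0 := norm_nonneg ((ξ : ℂ) - y)
  have hz0 := norm_nonneg ((ξ : ℂ) - z)
  set X' := ‖(ξ : ℂ) - x‖
  set Y' := ‖(ξ : ℂ) - y‖
  set Z' := ‖(ξ : ℂ) - z‖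
  have key : ∀ {s t u : ℝ}, 0 ≤ s → 0 ≤ t → 0 ≤ u → s ≤ t → s ≤ u →
      s * (t * u + s * u + s * t) ≤ 3 * (s * t * u) := by
    intro s t u hs ht hu hst hsu
    nlinarith [mul_le_mul_of_nonneg_left hst (mul_nonneg hs hu),
      mul_le_mul_of_nonneg_left hsu (mul_nonneg hs ht)]
  have hroot : ∀ w : ℂ, (w - x) * (w - y) * (w - z) = 0 → w ^ 3 + p * w ^ 2 + q * w + r = 0 := by
    intro w hw
    rw [← hw, hb, hc, hd]; ring
  rcases le_total X' Y' with hxy | hxy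
  · rcases le_total X' Z' with hxz | hxz
    · exact ⟨x, hroot x (by simp), (mul_le_mul_of_nonneg_left hder' hx0).trans
        (key hx0 hy0 hz0 hxy hxz)⟩
    · refine ⟨z, hroot z (by simp), (mul_le_mul_of_nonneg_left hder' hz0).trans ?_⟩
      linarith [key hz0 hx0 hy0 hxz (hxz.trans hxy)]
  · rcases le_total Y' Z' with hyz | hyz
    · refine ⟨y, hroot y (by simp), (mul_le_mul_of_nonneg_left hder' hy0).trans ?_⟩
      linarith [key hy0 hx0 hz0 hxy hyz]
    · refine ⟨z, hroot z (by simp), (mul_le_mul_of_nonneg_left hder' hz0).trans ?_⟩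
      linarith [key hz0 hx0 hy0 (hyz.trans hxy) hyz]

open Polynomial in
/-- An algebraic integer of degree at most `3` is a root of a monic integer cubic, namely
`X ^ (3 - d) * minpoly ℤ α`, whose coefficients are bounded by its height. -/
theorem exists_monicCubic {α : ℂ} (hα : IsIntegral ℤ α) (hd : (minpoly ℚ α).natDegree ≤ 3) :
    ∃ p q r : ℤ, p.natAbs ≤ height α ∧ q.natAbs ≤ height α ∧ r.natAbs ≤ height α ∧
      α ^ 3 + p * α ^ 2 + q * α + r = 0 := by
  rw [natDegree_minpoly_rat hα] at hd
  set Q := minpoly ℤ α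
  have hmonic : Q.Monic := minpoly.monic hα
  set P : ℤ[X] := Q * X ^ (3 - Q.natDegree) with hP
  have hPm : P.Monic := hmonic.mul (monic_X_pow _)
  have hPd : P.natDegree = 3 := by
    rw [hP, hmonic.natDegree_mul (monic_X_pow _), natDegree_X_pow]; omega
  have hPc : ∀ i, (P.coeff i).natAbs ≤ height α := by
    intro i
    rw [hP, coeff_mul_X_pow']
    split_ifs
    · exact natAbs_coeff_le_polyHeight _ _
    · simp
  refine ⟨P.coeff 2, P.coeff 1, P.coeff 0, hPc _, hPc _, hPc _, ?_⟩
  have h0 : aeval α P = 0 := by rw [hP, map_mul, minpoly.aeval, zero_mul]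
  rw [aeval_eq_sum_range, hPd] at h0
  have h3 : P.coeff 3 = 1 := hPd ▸ hPm.coeff_natDegree
  simp only [Finset.sum_range_succ, Finset.range_zero, Finset.sum_empty, h3] at h0
  simp only [zsmul_eq_mul, pow_zero, pow_one, Int.cast_one, one_mul, mul_one, zero_add] at h0
  rw [← h0]; ring

theorem finite_height_le (N : ℕ) :
    {α : ℂ | IsIntegral ℤ α ∧ (minpoly ℚ α).natDegree ≤ 3 ∧ height α ≤ N}.Finite := by
  have hfin : ∀ t : ℤ × ℤ × ℤ,
      {α : ℂ | α ^ 3 + t.1 * α ^ 2 + t.2.1 * α + t.2.2 = 0}.Finite := by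
    intro t
    have hne : (⟨1, t.1, t.2.1, t.2.2⟩ : Cubic ℂ).toPoly ≠ 0 :=
      Cubic.ne_zero_of_a_ne_zero one_ne_zero
    refine (Multiset.finite_toSet (⟨1, t.1, t.2.1, t.2.2⟩ : Cubic ℂ).toPoly.roots).subset ?_
    intro α hα
    have : α ^ 3 + t.1 * α ^ 2 + t.2.1 * α + t.2.2 = 0 := hα
    simp only [Set.mem_ofPred_eq, Polynomial.mem_roots hne, Polynomial.IsRoot]
    simpa [Cubic.toPoly] using this
  set I : Set ℤ := Set.Icc (-N : ℤ) N
  have hI : (I ×ˢ I ×ˢ I).Finite :=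
    (Set.finite_Icc _ _).prod ((Set.finite_Icc _ _).prod (Set.finite_Icc _ _))
  refine (hI.biUnion fun t _ => hfin t).subset ?_
  rintro α ⟨h1, h2, h3⟩
  obtain ⟨p, q, r, hp, hq, hr, h⟩ := exists_monicCubic h1 h2
  simp only [Set.mem_iUnion]
  refine ⟨(p, q, r), ?_, h⟩
  simp only [I, Set.mem_prod, Set.mem_Icc]
  omega

/-! ### Points approximating `(1, ξ, ξ²)` -/

theorem tendsto_atTop_of_two_mul_le {u : ℕ → ℤ} (h1 : ∀ k, 1 ≤ u k)
    (h2 : ∀ k, 2 * u k ≤ u (k + 1)) : Tendsto (fun k => (u k : ℝ)) atTop atTop :=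
  tendsto_intCast_atTop_atTop.comp <| by
    refine tendsto_atTop_mono (f := fun k : ℕ => (k : ℤ)) (fun k => ?_) tendsto_natCast_atTop_atTop
    induction k with
    | zero => simpa using (zero_le_one.trans (h1 0))
    | succ k ih => have := h1 k; have := h2 k; push_cast; omega

/-- Integer points `(u k, v k, w k)` of determinant `u w - v² = ±1` that approximate
`u k • (1, ξ, ξ²)` to within `C / u k`, that grow like `u (k + 2) ≍ u (k + 1) u k`, and such that
any three consecutive ones form a basis of `ℤ³`. -/
structure ApproxSeq (ξ C : ℝ) (u v w : ℕ → ℤ) : Prop where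
  one_le_C : 1 ≤ C
  one_le : ∀ k, 1 ≤ u k
  two_mul_le : ∀ k, 2 * u k ≤ u (k + 1)
  mul_le : ∀ k, u (k + 1) * u k ≤ u (k + 2)
  le_mul : ∀ k, (u (k + 2) : ℝ) ≤ C * (u (k + 1) * u k)
  abs_sub_le_one : ∀ k, |(u k : ℝ) * ξ - v k| ≤ C / u k
  abs_sub_le_two : ∀ k, |(u k : ℝ) * ξ ^ 2 - w k| ≤ C / u k
  det : ∀ k, |u k * w k - v k ^ 2| = 1
  det_three : ∀ k, |u k * (v (k + 1) * w (k + 2) - w (k + 1) * v (k + 2)) +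
    v k * (w (k + 1) * u (k + 2) - u (k + 1) * w (k + 2)) +
    w k * (u (k + 1) * v (k + 2) - v (k + 1) * u (k + 2))| = 1

namespace ApproxSeq

variable {ξ C : ℝ} {u v w : ℕ → ℤ}

theorem one_le_cast (h : ApproxSeq ξ C u v w) (k : ℕ) : (1 : ℝ) ≤ u k := by
  exact_mod_cast h.one_le k

theorem strictMono (h : ApproxSeq ξ C u v w) : StrictMono u :=
  strictMono_nat_of_lt_succ fun k => by linarith [h.one_le k, h.two_mul_le k]

theorem tendsto_atTop (h : ApproxSeq ξ C u v w) :
    Tendsto (fun k => (u k : ℝ)) atTop atTop :=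
  tendsto_atTop_of_two_mul_le h.one_le h.two_mul_le

/-- The recurrence `u (k + 2) ≍ u (k + 1) u k` forces `u (k + 1) ≍ (u k) ^ φ`: the differences
`log u (k + 1) - φ log u k` satisfy `d (k + 1) = O(1) - d k / φ`, hence are bounded. -/
theorem exists_growth (h : ApproxSeq ξ C u v w) :
    ∃ G : ℝ, 1 ≤ G ∧ ∀ k, (u (k + 1) : ℝ) ≤ G * (u k : ℝ) ^ Real.goldenRatio ∧
      (u k : ℝ) ^ Real.goldenRatio ≤ G * u (k + 1) := by
  set φ := Real.goldenRatio with hφ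
  have hφ1 : 1 < φ := Real.one_lt_goldenRatio
  have hφ2 : φ < 2 := Real.goldenRatio_lt_two
  have hφq : φ ^ 2 = φ + 1 := Real.goldenRatio_sq
  have hu : ∀ k, (0 : ℝ) < u k := fun k => one_pos.trans_le (h.one_le_cast k)
  set l : ℕ → ℝ := fun k => Real.log (u k) with hl
  have hl1 : ∀ k, l (k + 1) + l k ≤ l (k + 2) := fun k => by
    rw [hl]; simp only
    rw [← Real.log_mul (hu _).ne' (hu _).ne']
    exact Real.log_le_log (mul_pos (hu _) (hu _)) (by exact_mod_cast h.mul_le k)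
  have hC0 : 0 < C := one_pos.trans_le h.one_le_C
  have hl2 : ∀ k, l (k + 2) ≤ Real.log C + (l (k + 1) + l k) := fun k => by
    rw [hl]; simp only
    rw [← Real.log_mul (hu _).ne' (hu _).ne', ← Real.log_mul hC0.ne'
      (mul_pos (hu _) (hu _)).ne']
    exact Real.log_le_log (hu _) (h.le_mul k)
  have hL : 0 ≤ Real.log C := Real.log_nonneg h.one_le_C
  set B := max |l 1 - φ * l 0| (Real.log C / (2 - φ)) with hB
  have hBL : Real.log C ≤ B * (2 - φ) :=
    (div_le_iff₀ (by linarith)).mp (le_max_right _ _)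
  have hB0 : 0 ≤ B := (abs_nonneg _).trans (le_max_left _ _)
  have hd : ∀ k, |l (k + 1) - φ * l k| ≤ B := by
    intro k
    induction k with
    | zero => exact le_max_left _ _
    | succ k ih =>
      have e : l (k + 2) - φ * l (k + 1) =
          (l (k + 2) - (l (k + 1) + l k)) - (φ - 1) * (l (k + 1) - φ * l k) := by
        linear_combination (-l k) * hφq
      rw [abs_le] at ih ⊢
      rw [e]
      have h1 := hl1 k
      have h2 := hl2 k
      constructor
      · nlinarith [mul_le_mul_of_nonneg_left ih.2 (sub_pos.2 hφ1).le]
      · nlinarith [mul_le_mul_of_nonneg_left ih.1 (sub_pos.2 hφ1).le]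
  refine ⟨Real.exp B, Real.one_le_exp hB0, fun k => ?_⟩
  have hk := abs_le.mp (hd k)
  have e1 : (u k : ℝ) ^ φ = Real.exp (φ * l k) := by
    rw [Real.rpow_def_of_pos (hu k), mul_comm]
  have e2 : (u (k + 1) : ℝ) = Real.exp (l (k + 1)) := (Real.exp_log (hu _)).symm
  rw [e1, e2, ← Real.exp_add, ← Real.exp_add]
  exact ⟨Real.exp_le_exp.mpr (by linarith), Real.exp_le_exp.mpr (by linarith)⟩

end ApproxSeq

theorem distInt_le (x : ℝ) (m : ℤ) : distInt x ≤ |x - m| := round_le x m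

theorem distInt_le_half (x : ℝ) : distInt x ≤ 1 / 2 := abs_sub_round x

/-- If `|ξ - α| ≤ ρ ≤ 1` then a monic cubic vanishing at `α` is `O(H ρ)` at `ξ`. -/
theorem abs_eval_le {p q r : ℤ} {ξ H ρ : ℝ} {α : ℂ} (hH : 1 ≤ H) (hp : |(p : ℝ)| ≤ H)
    (hq : |(q : ℝ)| ≤ H) (hα : α ^ 3 + p * α ^ 2 + q * α + r = 0)
    (hρ : ‖(ξ : ℂ) - α‖ ≤ ρ) (hρ1 : ρ ≤ 1) :
    |ξ ^ 3 + p * ξ ^ 2 + q * ξ + r| ≤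
      (3 * (|ξ| + 1) ^ 2 + 2 * (|ξ| + 1) + 1) * (H * ρ) := by
  set R := |ξ| + 1 with hR
  have hR0 : 0 ≤ R := by positivity
  have hξ : ‖(ξ : ℂ)‖ ≤ R := by simp [hR]
  have hαR : ‖α‖ ≤ R := by
    have := norm_sub_le (ξ : ℂ) ((ξ : ℂ) - α)
    rw [sub_sub_cancel, Complex.norm_real, Real.norm_eq_abs] at this
    linarith
  have e : ((ξ ^ 3 + p * ξ ^ 2 + q * ξ + r : ℝ) : ℂ) =
      ((ξ : ℂ) - α) * ((ξ : ℂ) ^ 2 + ξ * α + α ^ 2 + p * (ξ + α) + q) := by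
    push_cast; linear_combination hα
  rw [← Real.norm_eq_abs, ← Complex.norm_real, e, norm_mul]
  have hp' : ‖(p : ℂ)‖ ≤ H := by rwa [Complex.norm_intCast]
  have hq' : ‖(q : ℂ)‖ ≤ H := by rwa [Complex.norm_intCast]
  have h2 : ‖(ξ : ℂ) ^ 2 + ξ * α + α ^ 2 + p * (ξ + α) + q‖ ≤
      R ^ 2 + R * R + R ^ 2 + H * (R + R) + H := by
    refine (norm_add_le _ _).trans (add_le_add ((norm_add_le _ _).trans (add_le_add
      (norm_add₃_le.trans (add_le_add_three ?_ ?_ ?_)) ?_)) hq')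
    · rw [norm_pow]; gcongr
    · rw [norm_mul]; gcongr
    · rw [norm_pow]; gcongr
    · rw [norm_mul]
      exact mul_le_mul hp' ((norm_add_le _ _).trans (add_le_add hξ hαR)) (norm_nonneg _)
        (by linarith)
  have hρ0 : 0 ≤ ρ := (norm_nonneg _).trans hρ
  calc _ ≤ ρ * (R ^ 2 + R * R + R ^ 2 + H * (R + R) + H) := by gcongr
    _ ≤ ρ * (3 * R ^ 2 * H + H * (R + R) + H) := by
      gcongr
      nlinarith [mul_le_mul_of_nonneg_left hH (sq_nonneg R)]
    _ = _ := by ring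

namespace ApproxSeq

variable {ξ C : ℝ} {u v w : ℕ → ℤ}

theorem distInt_mul_cube_le (h : ApproxSeq ξ C u v w) {p q r : ℤ} {H : ℝ} (hp : |(p : ℝ)| ≤ H)
    (hq : |(q : ℝ)| ≤ H) (k : ℕ) :
    distInt (u k * ξ ^ 3) ≤ u k * |ξ ^ 3 + p * ξ ^ 2 + q * ξ + r| + 2 * C * (H / u k) := by
  have hu := one_pos.trans_le (h.one_le_cast k)
  have hC0 : 0 < C := one_pos.trans_le h.one_le_C
  refine (distInt_le _ (-(p * w k + q * v k + r * u k))).trans ?_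
  have e : (u k : ℝ) * ξ ^ 3 - ((-(p * w k + q * v k + r * u k) : ℤ) : ℝ) =
      u k * (ξ ^ 3 + p * ξ ^ 2 + q * ξ + r) - (p * (u k * ξ ^ 2 - w k) + q * (u k * ξ - v k)) := by
    push_cast; ring
  rw [e]
  refine (abs_sub _ _).trans ?_
  rw [abs_mul, abs_of_pos hu]
  gcongr
  refine (abs_add_le _ _).trans ?_
  rw [abs_mul, abs_mul]
  calc _ ≤ H * (C / u k) + H * (C / u k) := by
        gcongr
        exacts [(abs_nonneg _).trans hp, h.abs_sub_le_two k, (abs_nonneg _).trans hp,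
          h.abs_sub_le_one k]
    _ = _ := by ring

/-! ### From cubic approximations to small `{u k ξ³}` -/

/-- The implication from good cubic approximations to small `{u k ξ³}`. If `P` is a monic cubic of
height `H` with `|P(ξ)| ≪ H ^ (-φ - ε)`, then `{u k ξ³} ≪ u k |P(ξ)| + H / u k`, which is small as
soon as `u k` lies between `H ^ (1 + η)` and `H ^ (φ + ε - η)`; since `u (k + 1) ≪ (u k) ^ φ` this
range contains some `u k`. -/
theorem frequently_distInt_le (h : ApproxSeq ξ C u v w) (hξ : CubicApprox ξ) :
    ∃ δ : ℝ, 0 < δ ∧ ∃ᶠ k in atTop, distInt (u k * ξ ^ 3) ≤ (u k : ℝ) ^ (-δ) := by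
  obtain ⟨θ, hθ, hinf⟩ := hξ
  obtain ⟨G, hG1, hG⟩ := h.exists_growth
  set φ := Real.goldenRatio with hφ
  have hφ1 : 1 < φ := Real.one_lt_goldenRatio
  have hφq : φ ^ 2 = φ + 1 := Real.goldenRatio_sq
  obtain ⟨ε, hε, rfl⟩ : ∃ ε, 0 < ε ∧ θ = φ ^ 2 + ε := ⟨θ - φ ^ 2, by linarith, by ring⟩
  set η := ε / (2 * φ) with hη
  have hη0 : 0 < η := by positivity
  have hφη : (1 + η) * φ = φ + ε / 2 := by rw [hη]; field_simp
  have hηε : η ≤ ε / 2 := by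
    rw [hη]; gcongr; linarith
  set δ := η / 2 / (φ + ε / 2) with hδ
  have hδ0 : 0 < δ := by positivity
  refine ⟨δ, hδ0, ?_⟩
  have hC0 : 0 < C := one_pos.trans_le h.one_le_C
  have hG0 : 0 < G := one_pos.trans_le hG1
  set K := 3 * (|ξ| + 1) ^ 2 + 2 * (|ξ| + 1) + 1 with hK
  have hK0 : 0 < K := by positivity
  rw [Filter.frequently_atTop]
  intro N
  obtain ⟨B, hB⟩ := ((tendsto_rpow_atTop (half_pos hη0)).eventually_ge_atTop
    ((G * K + 2 * C) * G ^ δ)).exists_forall_of_atTop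
  obtain ⟨α, ⟨hα1, hα2, hα3⟩, hαH⟩ : ∃ α ∈ {α : ℂ | IsIntegral ℤ α ∧ (minpoly ℚ α).natDegree ≤ 3 ∧
      ‖(ξ : ℂ) - α‖ ≤ (height α : ℝ) ^ (-(φ ^ 2 + ε))},
      max ⌈B⌉₊ (u N).toNat < height α := by
    by_contra! hcon
    exact hinf ((finite_height_le _).subset fun α hα => ⟨hα.1, hα.2.1, hcon α hα⟩)
  obtain ⟨p, q, r, hp, hq, -, hroot⟩ := exists_monicCubic hα1 hα2
  set H : ℝ := ((height α : ℕ) : ℝ) with hH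
  have hH1 : 1 ≤ H := by rw [hH]; exact_mod_cast one_le_height hα1
  have hH0 : 0 < H := one_pos.trans_le hH1
  have hHB : B ≤ H := (Nat.le_ceil B).trans
    (by rw [hH]; exact_mod_cast (le_max_left _ _).trans hαH.le)
  have hHN : (u N : ℝ) < H := by
    have h1 : (u N).toNat < height α := (le_max_right _ _).trans_lt hαH
    have h2 : u N < (height α : ℤ) := by omega
    rw [hH]; exact_mod_cast h2
  have hp' : |(p : ℝ)| ≤ H := by
    rw [hH, ← Int.cast_abs, ← Nat.cast_natAbs]; exact_mod_cast hp
  have hq' : |(q : ℝ)| ≤ H := by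
    rw [hH, ← Int.cast_abs, ← Nat.cast_natAbs]; exact_mod_cast hq
  have hP := abs_eval_le hH1 hp' hq' hroot hα3
    (Real.rpow_le_one_of_one_le_of_nonpos hH1 (by nlinarith))
  have hHρ : H * H ^ (-(φ ^ 2 + ε)) = H ^ (-φ - ε) := by
    nth_rw 1 [← Real.rpow_one H]
    rw [← Real.rpow_add hH0, hφq]; congr 1; ring
  rw [hHρ, ← hK] at hP
  have hHη : H ≤ H ^ (1 + η) := Real.self_le_rpow_of_one_le hH1 (by linarith)
  have hex : ∃ k, H ^ (1 + η) ≤ u k := (h.tendsto_atTop.eventually_ge_atTop _).exists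
  classical
  have hk := Nat.find_spec hex
  have hmin := fun m => Nat.find_min hex (m := m)
  set k := Nat.find hex
  have hNk : N < k := by
    by_contra! hle
    have : (u k : ℝ) ≤ u N := by exact_mod_cast h.strictMono.monotone hle
    linarith
  refine ⟨k, hNk.le, ?_⟩
  have huk0 := one_pos.trans_le (h.one_le_cast k)
  have huk : (u k : ℝ) ≤ G * H ^ (φ + ε / 2) := by
    obtain ⟨m, hkm⟩ := Nat.exists_eq_succ_of_ne_zero (by omega : k ≠ 0)
    have hm : (u m : ℝ) < H ^ (1 + η) := not_le.mp (hmin m (by omega))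
    rw [hkm]
    refine (hG m).1.trans ?_
    rw [← hφη, Real.rpow_mul hH0.le]
    gcongr
    exact_mod_cast zero_le_one.trans (h.one_le m)
  have h1 : u k * |ξ ^ 3 + p * ξ ^ 2 + q * ξ + r| ≤ G * K * H ^ (-η) := by
    calc _ ≤ (G * H ^ (φ + ε / 2)) * (K * H ^ (-φ - ε)) := by gcongr
      _ = G * K * H ^ (-(ε / 2)) := by
        rw [show -(ε / 2) = (φ + ε / 2) + (-φ - ε) by ring,
          Real.rpow_add hH0 (φ + ε / 2) (-φ - ε)]; ring
      _ ≤ _ := by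
        gcongr
  have h2 : 2 * C * (H / u k) ≤ 2 * C * H ^ (-η) := by
    gcongr
    rw [div_le_iff₀ huk0]
    calc H = H ^ (-η) * H ^ (1 + η) := by
          rw [← Real.rpow_add hH0]; simp
      _ ≤ _ := by gcongr
  have h3 : (G * K + 2 * C) * H ^ (-η) ≤ (G * H ^ (φ + ε / 2)) ^ (-δ) := by
    have hB' := hB H hHB
    rw [Real.mul_rpow hG0.le (by positivity), ← Real.rpow_mul hH0.le,
      show (φ + ε / 2) * -δ = -(η / 2) by rw [hδ]; field_simp, Real.rpow_neg hG0.le, inv_mul_eq_div,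
      le_div_iff₀ (by positivity)]
    calc _ = (G * K + 2 * C) * G ^ δ * H ^ (-η) := by ring
      _ ≤ H ^ (η / 2) * H ^ (-η) := by gcongr
      _ = _ := by rw [← Real.rpow_add hH0]; congr 1; ring
  calc _ ≤ _ := h.distInt_mul_cube_le hp' hq' (r := r) k
    _ ≤ (G * K + 2 * C) * H ^ (-η) := by linarith
    _ ≤ _ := h3
    _ ≤ _ := Real.rpow_le_rpow_of_nonpos huk0 huk (by linarith)

/-! ### From small `{u k ξ³}` to cubic approximations -/

theorem abs_int_form_le (h : ApproxSeq ξ C u v w) {a b c : ℤ}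
    (h0 : (a : ℝ) + b * ξ + c * ξ ^ 2 = 0) (k : ℕ) :
    |((a * u k + b * v k + c * w k : ℤ) : ℝ)| ≤ (|(b : ℝ)| + |(c : ℝ)|) * C / u k := by
  have e : ((a * u k + b * v k + c * w k : ℤ) : ℝ) =
      -(b * (u k * ξ - v k) + c * (u k * ξ ^ 2 - w k)) := by
    push_cast; linear_combination (u k : ℝ) * h0
  rw [e, abs_neg]
  refine (abs_add_le _ _).trans ?_
  rw [abs_mul, abs_mul, add_mul, add_div, mul_div_assoc, mul_div_assoc]
  gcongr
  exacts [h.abs_sub_le_one k, h.abs_sub_le_two k]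

/-- `1, ξ, ξ²` are linearly independent over `ℚ`: an integer relation takes small integer values at
the points of the sequence, so it vanishes at three consecutive ones, which form a basis. -/
theorem eq_zero_of_relation (h : ApproxSeq ξ C u v w) {a b c : ℤ}
    (h0 : (a : ℝ) + b * ξ + c * ξ ^ 2 = 0) : a = 0 ∧ b = 0 ∧ c = 0 := by
  obtain ⟨N, hN⟩ := (h.tendsto_atTop.eventually_gt_atTop
    ((|(b : ℝ)| + |(c : ℝ)|) * C)).exists_forall_of_atTop
  have hz : ∀ k, N ≤ k → a * u k + b * v k + c * w k = 0 := by
    intro k hk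
    have h1 : |((a * u k + b * v k + c * w k : ℤ) : ℝ)| < 1 := by
      refine (h.abs_int_form_le h0 k).trans_lt ?_
      rw [div_lt_one (one_pos.trans_le (h.one_le_cast k))]
      exact hN k hk
    rw [← Int.cast_abs, ← Int.cast_one, Int.cast_lt, Int.abs_lt_one_iff] at h1
    exact h1
  have e0 := hz N le_rfl
  have e1 := hz (N + 1) (by omega)
  have e2 := hz (N + 2) (by omega)
  have hd := h.det_three N
  set D := u N * (v (N + 1) * w (N + 2) - w (N + 1) * v (N + 2)) +
    v N * (w (N + 1) * u (N + 2) - u (N + 1) * w (N + 2)) +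
    w N * (u (N + 1) * v (N + 2) - v (N + 1) * u (N + 2)) with hD
  have hD0 : D ≠ 0 := by
    intro h0
    simp [h0] at hd
  refine ⟨?_, ?_, ?_⟩ <;> refine (mul_eq_zero.mp ?_).resolve_right hD0 <;> rw [hD]
  · linear_combination (v (N + 1) * w (N + 2) - w (N + 1) * v (N + 2)) * e0 +
      (v (N + 2) * w N - w (N + 2) * v N) * e1 + (v N * w (N + 1) - w N * v (N + 1)) * e2
  · linear_combination (w (N + 1) * u (N + 2) - u (N + 1) * w (N + 2)) * e0 +
      (w (N + 2) * u N - u (N + 2) * w N) * e1 + (w N * u (N + 1) - u N * w (N + 1)) * e2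
  · linear_combination (u (N + 1) * v (N + 2) - v (N + 1) * u (N + 2)) * e0 +
      (u (N + 2) * v N - v (N + 2) * u N) * e1 + (u N * v (N + 1) - v N * u (N + 1)) * e2

/-- At most one monic integer cubic vanishes at `ξ`, so the derivatives at `ξ` of such cubics are
bounded. -/
theorem exists_deriv_bound (h : ApproxSeq ξ C u v w) :
    ∃ T : ℝ, ∀ p q r : ℤ, ξ ^ 3 + p * ξ ^ 2 + q * ξ + r = 0 →
      |3 * ξ ^ 2 + 2 * p * ξ + q| ≤ T := by
  by_cases hex : ∃ p q r : ℤ, ξ ^ 3 + p * ξ ^ 2 + q * ξ + r = 0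
  · obtain ⟨p, q, r, h0⟩ := hex
    refine ⟨|3 * ξ ^ 2 + 2 * p * ξ + q|, fun p' q' r' h1 => ?_⟩
    obtain ⟨-, hq, hp⟩ := h.eq_zero_of_relation (a := r' - r) (b := q' - q) (c := p' - p)
      (by push_cast; linear_combination h1 - h0)
    rw [sub_eq_zero.mp hq, sub_eq_zero.mp hp]
  · push Not at hex
    exact ⟨0, fun p q r h0 => absurd h0 (hex p q r)⟩

theorem abs_minor_one_le (h : ApproxSeq ξ C u v w) (i j : ℕ) :
    |(u i : ℝ) * v j - v i * u j| ≤ C * (u i / u j + u j / u i) := by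
  have hi := one_pos.trans_le (h.one_le_cast i)
  have hj := one_pos.trans_le (h.one_le_cast j)
  have e : (u i : ℝ) * v j - v i * u j = u j * (u i * ξ - v i) - u i * (u j * ξ - v j) := by ring
  rw [e]
  refine (abs_sub _ _).trans ?_
  rw [abs_mul, abs_mul, abs_of_pos hi, abs_of_pos hj]
  calc _ ≤ u j * (C / u i) + u i * (C / u j) := by
        gcongr
        exacts [h.abs_sub_le_one i, h.abs_sub_le_one j]
    _ = _ := by ring

theorem abs_minor_two_le (h : ApproxSeq ξ C u v w) (i j : ℕ) :
    |(w i : ℝ) * u j - u i * w j| ≤ C * (u i / u j + u j / u i) := by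
  have hi := one_pos.trans_le (h.one_le_cast i)
  have hj := one_pos.trans_le (h.one_le_cast j)
  have e : (w i : ℝ) * u j - u i * w j =
      u i * (u j * ξ ^ 2 - w j) - u j * (u i * ξ ^ 2 - w i) := by ring
  rw [e]
  refine (abs_sub _ _).trans ?_
  rw [abs_mul, abs_mul, abs_of_pos hi, abs_of_pos hj]
  calc _ ≤ u i * (C / u j) + u j * (C / u i) := by
        gcongr
        exacts [h.abs_sub_le_two j, h.abs_sub_le_two i]
    _ = _ := by ring

/-- The pairs of indices among `k, k + 1, k + 2`, with the growth `u (k + 2) ≤ C u (k + 1) u k`,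
have ratios bounded by `u (k + 1)`. -/
theorem ratio_bounds (h : ApproxSeq ξ C u v w) (k : ℕ) :
    C * ((u (k + 1) : ℝ) / u (k + 2) + u (k + 2) / u (k + 1)) ≤ 2 * C ^ 2 * u (k + 1) ∧
    C * ((u (k + 2) : ℝ) / u k + u k / u (k + 2)) ≤ 2 * C ^ 2 * u (k + 1) ∧
    C * ((u k : ℝ) / u (k + 1) + u (k + 1) / u k) ≤ 2 * C ^ 2 * u (k + 1) := by
  have h0 := h.one_le_cast k
  have h1 := h.one_le_cast (k + 1)
  have h2 := h.one_le_cast (k + 2)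
  have hC := h.one_le_C
  have h01 : (u k : ℝ) ≤ u (k + 1) := by exact_mod_cast (h.strictMono (Nat.lt_succ_self k)).le
  have h12 : (u (k + 1) : ℝ) ≤ u (k + 2) := by
    exact_mod_cast (h.strictMono (Nat.lt_succ_self (k + 1))).le
  have hle := h.le_mul k
  have hCt : 1 ≤ C * u (k + 1) := one_le_mul_of_one_le_of_one_le hC h1
  have key : ∀ x y : ℝ, x ≤ 1 → y ≤ C * u (k + 1) → C * (x + y) ≤ 2 * C ^ 2 * u (k + 1) := by
    intro x y hx hy
    have : C * (x + y) ≤ C * (C * u (k + 1) + C * u (k + 1)) := by gcongr; linarith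
    linarith
  refine ⟨key _ _ (div_le_one_of_le₀ h12 (by linarith)) ?_, ?_,
    key _ _ (div_le_one_of_le₀ h01 (by linarith)) ?_⟩
  · rw [div_le_iff₀ (by linarith)]
    refine hle.trans ?_
    have : C * u (k + 1) * u k ≤ C * u (k + 1) * u (k + 1) := by gcongr
    linarith
  · rw [add_comm]
    refine key _ _ (div_le_one_of_le₀ (h01.trans h12) (by linarith)) ?_
    rw [div_le_iff₀ (by linarith)]
    linarith
  · rw [div_le_iff₀ (by linarith)]
    have : (1 : ℝ) * u (k + 1) ≤ C * u (k + 1) := by gcongr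
    nlinarith [mul_le_mul_of_nonneg_left h0 (zero_le_one.trans hCt)]

/-- The quadratic polynomial with coefficients `y (k + 2) ∧ y k` has a large derivative at `ξ`. The
reason is that `u (η₂ - 2 ξ η₁) = ∓1 - η₁²` for a point `(u, v, w)` of determinant `±1` with errors
`η₁ = u ξ - v` and `η₂ = u ξ² - w`. -/
theorem half_le_abs_deriv_minor (h : ApproxSeq ξ C u v w) {k : ℕ} (hk : 2 * C ≤ u k)
    (hk4 : 4 ≤ u k) :
    (u (k + 1) : ℝ) / 2 ≤ |2 * ξ * ((u (k + 2) : ℝ) * v k - v (k + 2) * u k) +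
      ((w (k + 2) : ℝ) * u k - u (k + 2) * w k)| := by
  have hu0 : (4 : ℝ) ≤ u k := by exact_mod_cast hk4
  have hC := h.one_le_C
  have h01 : (u k : ℝ) ≤ u (k + 1) := by exact_mod_cast (h.strictMono (Nat.lt_succ_self k)).le
  have h02 : (u k : ℝ) ≤ u (k + 2) := by
    exact_mod_cast (h.strictMono (by omega : k < k + 2)).le
  have hmul : (u (k + 1) : ℝ) * u k ≤ u (k + 2) := by exact_mod_cast h.mul_le k
  have small : ∀ j, (u k : ℝ) ≤ u j → |(u j : ℝ) * ξ - v j| ≤ 1 / 2 := by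
    intro j hj
    refine (h.abs_sub_le_one j).trans ?_
    rw [div_le_iff₀ (by linarith)]
    linarith
  have main : ∀ j, (u k : ℝ) ≤ u j →
      3 / 4 ≤ |(u j : ℝ) * ((u j * ξ ^ 2 - w j) - 2 * ξ * (u j * ξ - v j))| ∧
      |(u j : ℝ) * ((u j * ξ ^ 2 - w j) - 2 * ξ * (u j * ξ - v j))| ≤ 5 / 4 := by
    intro j hj
    have hs := small j hj
    have hsq : (u j * ξ - v j) ^ 2 ≤ (1 / 4 : ℝ) := by
      rw [← sq_abs]
      nlinarith [abs_nonneg ((u j : ℝ) * ξ - v j)]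
    have hdet : |(u j : ℝ) * w j - v j ^ 2| = 1 := by exact_mod_cast h.det j
    have e : (u j : ℝ) * ((u j * ξ ^ 2 - w j) - 2 * ξ * (u j * ξ - v j)) =
        -((u j * w j - v j ^ 2) + (u j * ξ - v j) ^ 2) := by ring
    rw [e, abs_neg]
    have hs0 := sq_nonneg ((u j : ℝ) * ξ - v j)
    rcases (abs_eq (zero_le_one)).mp hdet with hd | hd
    · rw [hd, abs_of_nonneg (by linarith)]
      constructor <;> linarith
    · rw [hd, abs_of_nonpos (by linarith)]
      constructor <;> linarith
  have hpos0 : (0 : ℝ) < u k := by linarith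
  have hpos1 : (0 : ℝ) < u (k + 1) := by linarith
  have hpos2 : (0 : ℝ) < u (k + 2) := by linarith
  set x := (u k * ξ ^ 2 - w k) - 2 * ξ * (u k * ξ - v k) with hx
  set y := (u (k + 2) * ξ ^ 2 - w (k + 2)) - 2 * ξ * (u (k + 2) * ξ - v (k + 2)) with hy
  have e : 2 * ξ * ((u (k + 2) : ℝ) * v k - v (k + 2) * u k) +
      ((w (k + 2) : ℝ) * u k - u (k + 2) * w k) = u (k + 2) * x - u k * y := by
    rw [hx, hy]; ring
  rw [e]
  have hx1 := (main k le_rfl).1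
  have hy1 := (main (k + 2) h02).2
  rw [abs_mul, abs_of_pos hpos0] at hx1
  rw [abs_mul, abs_of_pos hpos2] at hy1
  have h1 : (u (k + 1) : ℝ) * (3 / 4) ≤ |(u (k + 2) : ℝ) * x| := by
    rw [abs_mul, abs_of_pos hpos2]
    calc (u (k + 1) : ℝ) * (3 / 4) ≤ u (k + 1) * (u k * |x|) := by gcongr
      _ = u (k + 1) * u k * |x| := by ring
      _ ≤ _ := by gcongr
  have h2 : |(u k : ℝ) * y| ≤ 5 / 4 * (1 / 4) := by
    rw [abs_mul, abs_of_pos hpos0]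
    have h3 : |y| ≤ 5 / 4 / u (k + 2) := by
      rw [le_div_iff₀ hpos2]; linarith
    calc (u k : ℝ) * |y| ≤ u k * (5 / 4 / u (k + 2)) := by gcongr
      _ = 5 / 4 * (u k / u (k + 2)) := by ring
      _ ≤ 5 / 4 * (1 / 4) := by
        refine mul_le_mul_of_nonneg_left ?_ (by norm_num)
        rw [div_le_iff₀ hpos2]
        nlinarith
  have h3 := abs_sub_abs_le_abs_sub ((u (k + 2) : ℝ) * x) (u k * y)
  linarith

/-- Solving `(r, q, p) · y j = -⌊u j ξ³⌉` for `j = k, k + 1, k + 2`, where `y j = (u j, v j, w j)`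
and `⌊x⌉` is the integer nearest to `x`, gives a monic integer cubic which is small at `ξ`.
Replacing the right-hand side by `1 - ⌊u j ξ³⌉` at `j = k + 1` adds the polynomial
`± y (k + 2) ∧ y k`, so one of the two cubics has a large derivative at `ξ`. -/
theorem exists_cubic_small (h : ApproxSeq ξ C u v w) {k : ℕ} (hk : 2 * C ≤ u k) (hk4 : 4 ≤ u k) :
    ∃ p q r : ℤ, |(p : ℝ)| ≤ 8 * C ^ 2 * u (k + 1) ∧ |(q : ℝ)| ≤ 8 * C ^ 2 * u (k + 1) ∧
      (u (k + 1) : ℝ) / 4 ≤ |3 * ξ ^ 2 + 2 * p * ξ + q| ∧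
      u (k + 2) * |ξ ^ 3 + p * ξ ^ 2 + q * ξ + r| ≤
        distInt (u (k + 2) * ξ ^ 3) + 16 * C ^ 3 * (u (k + 1) / u (k + 2)) := by
  have hdet := h.det_three k
  obtain ⟨hb12, hb20, hb01⟩ := h.ratio_bounds k
  have hP12 := (h.abs_minor_one_le (k + 1) (k + 2)).trans hb12
  have hP20 := (h.abs_minor_one_le (k + 2) k).trans hb20
  have hP01 := (h.abs_minor_one_le k (k + 1)).trans hb01
  have hQ12 := (h.abs_minor_two_le (k + 1) (k + 2)).trans hb12
  have hQ20 := (h.abs_minor_two_le (k + 2) k).trans hb20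
  have hQ01 := (h.abs_minor_two_le k (k + 1)).trans hb01
  have hder := h.half_le_abs_deriv_minor hk hk4
  have happ1 := h.abs_sub_le_one (k + 2)
  have happ2 := h.abs_sub_le_two (k + 2)
  have hu2 := one_pos.trans_le (h.one_le_cast (k + 2))
  have hu1 := one_pos.trans_le (h.one_le_cast (k + 1))
  have hC0 := one_pos.trans_le h.one_le_C
  generalize u (k + 2) = u2 at *
  generalize v (k + 2) = v2 at *
  generalize w (k + 2) = w2 at *
  generalize u (k + 1) = u1 at *
  generalize v (k + 1) = v1 at *
  generalize w (k + 1) = w1 at *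
  generalize u k = u0 at *
  generalize v k = v0 at *
  generalize w k = w0 at *
  set D := u0 * (v1 * w2 - w1 * v2) + v0 * (w1 * u2 - u1 * w2) + w0 * (u1 * v2 - v1 * u2) with hD
  have hD2 : D * D = 1 := by rw [← abs_mul_abs_self, hdet, one_mul]
  have hDr : |(D : ℝ)| = 1 := by exact_mod_cast hdet
  -- the solution of the linear system by Cramer's rule, `s` being the shift at `j = k + 1`
  let p : ℤ → ℤ := fun s => D * (-round (u0 * ξ ^ 3) * (u1 * v2 - v1 * u2) +
    (s - round (u1 * ξ ^ 3)) * (u2 * v0 - v2 * u0) - round (u2 * ξ ^ 3) * (u0 * v1 - v0 * u1))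
  let q : ℤ → ℤ := fun s => D * (-round (u0 * ξ ^ 3) * (w1 * u2 - u1 * w2) +
    (s - round (u1 * ξ ^ 3)) * (w2 * u0 - u2 * w0) - round (u2 * ξ ^ 3) * (w0 * u1 - u0 * w1))
  let r : ℤ → ℤ := fun s => D * (-round (u0 * ξ ^ 3) * (v1 * w2 - w1 * v2) +
    (s - round (u1 * ξ ^ 3)) * (v2 * w0 - w2 * v0) - round (u2 * ξ ^ 3) * (v0 * w1 - w0 * v1))
  have hsys : ∀ s, r s * u2 + q s * v2 + p s * w2 = -round (u2 * ξ ^ 3) := by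
    intro s
    have : r s * u2 + q s * v2 + p s * w2 = -round (u2 * ξ ^ 3) * (D * D) := by
      simp only [p, q, r]
      conv_rhs => rw [hD]
      ring
    rw [this, hD2, mul_one]
  have r0 := distInt_le_half (u0 * ξ ^ 3)
  have r1 := distInt_le_half (u1 * ξ ^ 3)
  have r2 := distInt_le_half (u2 * ξ ^ 3)
  -- the vector `(-ξ³, 0, 0)` solves the system with right-hand sides `-u j ξ³`, so only the
  -- rounding errors contribute to `p` and `q`
  have small : ∀ x y z B : ℝ, |x| ≤ B → |y| ≤ B → |z| ≤ B → ∀ s : ℤ, s = 0 ∨ s = 1 →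
      |(u0 * ξ ^ 3 - round (u0 * ξ ^ 3)) * x + (s + (u1 * ξ ^ 3 - round (u1 * ξ ^ 3))) * y +
        (u2 * ξ ^ 3 - round (u2 * ξ ^ 3)) * z| ≤ 4 * B := by
    intro x y z B hx hy hz s hs
    have hs1 : |(s : ℝ)| ≤ 1 := by rcases hs with rfl | rfl <;> simp
    have hB : 0 ≤ B := (abs_nonneg _).trans hx
    refine abs_add_three _ _ _ |>.trans ?_
    rw [abs_mul, abs_mul, abs_mul]
    have h1 : |(s : ℝ) + (u1 * ξ ^ 3 - round (u1 * ξ ^ 3))| ≤ 3 / 2 :=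
      (abs_add_le _ _).trans (by unfold distInt at r1; linarith)
    calc _ ≤ 1 / 2 * B + 3 / 2 * B + 1 / 2 * B := by
          gcongr
          exacts [r0, r2]
      _ ≤ _ := by linarith
  have hp : ∀ s : ℤ, s = 0 ∨ s = 1 → |(p s : ℝ)| ≤ 8 * C ^ 2 * u1 := by
    intro s hs
    have e : (p s : ℝ) = D * ((u0 * ξ ^ 3 - round (u0 * ξ ^ 3)) * (u1 * v2 - v1 * u2) +
        (s + (u1 * ξ ^ 3 - round (u1 * ξ ^ 3))) * (u2 * v0 - v2 * u0) +
        (u2 * ξ ^ 3 - round (u2 * ξ ^ 3)) * (u0 * v1 - v0 * u1)) := by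
      simp only [p]; push_cast; ring
    rw [e, abs_mul, hDr, one_mul]
    exact (small _ _ _ _ hP12 hP20 hP01 s hs).trans_eq (by ring)
  have hq : ∀ s : ℤ, s = 0 ∨ s = 1 → |(q s : ℝ)| ≤ 8 * C ^ 2 * u1 := by
    intro s hs
    have e : (q s : ℝ) = D * ((u0 * ξ ^ 3 - round (u0 * ξ ^ 3)) * (w1 * u2 - u1 * w2) +
        (s + (u1 * ξ ^ 3 - round (u1 * ξ ^ 3))) * (w2 * u0 - u2 * w0) +
        (u2 * ξ ^ 3 - round (u2 * ξ ^ 3)) * (w0 * u1 - u0 * w1)) := by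
      simp only [q]; push_cast; ring
    rw [e, abs_mul, hDr, one_mul]
    exact (small _ _ _ _ hQ12 hQ20 hQ01 s hs).trans_eq (by ring)
  obtain ⟨s, hs, hs4⟩ : ∃ s : ℤ, (s = 0 ∨ s = 1) ∧
      (u1 : ℝ) / 4 ≤ |3 * ξ ^ 2 + 2 * p s * ξ + q s| := by
    by_contra! hcon
    have h0 := hcon 0 (Or.inl rfl)
    have h1 := hcon 1 (Or.inr rfl)
    have e : (3 * ξ ^ 2 + 2 * p 1 * ξ + q 1) - (3 * ξ ^ 2 + 2 * p 0 * ξ + q 0) =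
        D * (2 * ξ * ((u2 : ℝ) * v0 - v2 * u0) + ((w2 : ℝ) * u0 - u2 * w0)) := by
      simp only [p, q]; push_cast; ring
    have h2 := abs_sub (3 * ξ ^ 2 + 2 * p 1 * ξ + q 1) (3 * ξ ^ 2 + 2 * p 0 * ξ + q 0)
    rw [e, abs_mul, hDr, one_mul] at h2
    linarith
  refine ⟨p s, q s, r s, hp s hs, hq s hs, hs4, ?_⟩
  have e : u2 * (ξ ^ 3 + p s * ξ ^ 2 + q s * ξ + r s) = (u2 * ξ ^ 3 - round (u2 * ξ ^ 3)) +
      (p s * (u2 * ξ ^ 2 - w2) + q s * (u2 * ξ - v2)) := by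
    have : (r s * u2 + q s * v2 + p s * w2 : ℝ) = -round (u2 * ξ ^ 3) := by exact_mod_cast hsys s
    linear_combination this
  calc _ = |u2 * (ξ ^ 3 + p s * ξ ^ 2 + q s * ξ + r s)| := by rw [abs_mul, abs_of_pos hu2]
    _ ≤ distInt (u2 * ξ ^ 3) + (|(p s : ℝ)| * |u2 * ξ ^ 2 - w2| + |(q s : ℝ)| * |u2 * ξ - v2|) := by
      rw [e]
      refine (abs_add_le _ _).trans ?_
      unfold distInt
      gcongr
      refine (abs_add_le _ _).trans_eq ?_
      rw [abs_mul, abs_mul]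
    _ ≤ distInt (u2 * ξ ^ 3) + (8 * C ^ 2 * u1 * (C / u2) + 8 * C ^ 2 * u1 * (C / u2)) := by
      gcongr
      exacts [hp s hs, hq s hs]
    _ = _ := by ring

/-- The implication from small `{u k ξ³}` to good cubic approximations: the cubic of
`exists_cubic_small` has height `≪ t = u (k + 1)`, value `≪ t ^ (-φ - ε)` and derivative `≫ t` at
`ξ`, so its root nearest to `ξ` is at distance `≪ t ^ (-φ² - ε)`. -/
theorem cubicApprox (h : ApproxSeq ξ C u v w) {δ : ℝ} (hδ : 0 < δ)
    (hfreq : ∃ᶠ k in atTop, distInt (u k * ξ ^ 3) ≤ (u k : ℝ) ^ (-δ)) : CubicApprox ξ := by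
  obtain ⟨G, hG1, hG⟩ := h.exists_growth
  obtain ⟨T, hT⟩ := h.exists_deriv_bound
  set φ := Real.goldenRatio with hφ
  have hφ1 : 1 < φ := Real.one_lt_goldenRatio
  have hφq : φ ^ 2 = φ + 1 := Real.goldenRatio_sq
  have hC1 := h.one_le_C
  have hC0 : 0 < C := one_pos.trans_le hC1
  have hG0 : 0 < G := one_pos.trans_le hG1
  set ε := min (φ * δ) (φ - 1) with hε
  have hε0 : 0 < ε := lt_min (by positivity) (by linarith)
  set K := G * (G ^ δ + 16 * C ^ 3 * G) with hK
  have hK0 : 0 < K := by positivity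
  set K₁ := 12 * (K + |ξ| ^ 3 + 8 * C ^ 2 * (ξ ^ 2 + |ξ| + 1)) with hK₁
  have hK₁0 : 0 < K₁ := by positivity
  set θ := φ ^ 2 + ε / 2 with hθ
  have hθ0 : 0 < θ := by positivity
  refine ⟨θ, by linarith, ?_⟩
  set S : Set ℂ := {α : ℂ | IsIntegral ℤ α ∧ (minpoly ℚ α).natDegree ≤ 3 ∧
      ‖(ξ : ℂ) - α‖ ≤ (height α : ℝ) ^ (-θ)} with hS
  -- it suffices to find elements of `S`, other than `ξ`, arbitrarily close to `ξ`
  suffices hclose : ∀ ρ > 0, ∃ α ∈ S, α ≠ ξ ∧ ‖(ξ : ℂ) - α‖ < ρ by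
    intro hfin
    have hopen : IsOpen (S \ {(ξ : ℂ)})ᶜ := (hfin.subset Set.sdiff_subset).isClosed.isOpen_compl
    obtain ⟨ρ, hρ, hball⟩ := Metric.isOpen_iff.mp hopen ξ (by simp)
    obtain ⟨α, hαS, hαξ, hαρ⟩ := hclose ρ hρ
    have hmem : α ∈ Metric.ball (ξ : ℂ) ρ := by
      rwa [Metric.mem_ball, dist_comm, dist_eq_norm]
    exact hball hmem ⟨hαS, by simpa using hαξ⟩
  intro ρ hρ
  have hev : ∀ᶠ k in atTop, 2 * C ≤ u k ∧ (4 : ℝ) ≤ u k ∧ 4 * T < u (k + 1) ∧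
      12 * K / ρ < u (k + 1) ∧ 12 * K * K₁ ^ θ ≤ (u (k + 1) : ℝ) ^ (ε / 2) := by
    have h1 := h.tendsto_atTop.comp (tendsto_add_atTop_nat 1)
    filter_upwards [h.tendsto_atTop.eventually_ge_atTop (2 * C),
      h.tendsto_atTop.eventually_ge_atTop 4, h1.eventually_gt_atTop (4 * T),
      h1.eventually_gt_atTop (12 * K / ρ),
      ((tendsto_rpow_atTop (half_pos hε0)).comp h1).eventually_ge_atTop (12 * K * K₁ ^ θ)]
      with k e1 e2 e3 e4 e5
    exact ⟨e1, e2, e3, e4, e5⟩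
  have hfreq' : ∃ᶠ k in atTop,
      distInt (u (k + 2) * ξ ^ 3) ≤ (u (k + 2) : ℝ) ^ (-δ) := by
    rw [← map_add_atTop_eq_nat 2] at hfreq
    exact frequently_map.mp hfreq
  obtain ⟨k, hdist, hk, hk4, hkT, hkρ, hkK⟩ := (hfreq'.and_eventually hev).exists
  obtain ⟨p, q, r, hp, hq, hder, hval⟩ := h.exists_cubic_small hk (by exact_mod_cast hk4)
  have ht1 := h.one_le_cast (k + 1)
  have hu1 := h.one_le_cast (k + 2)
  have hgr := (hG (k + 1)).2
  rw [show k + 1 + 1 = k + 2 from rfl] at hgr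
  set t : ℝ := ((u (k + 1) : ℤ) : ℝ) with ht
  set x : ℝ := ((u (k + 2) : ℤ) : ℝ) with hx
  have ht0 : 0 < t := one_pos.trans_le ht1
  have hx0 : 0 < x := one_pos.trans_le hu1
  have hxinv : x⁻¹ ≤ G * t ^ (-φ) := by
    rw [Real.rpow_neg ht0.le, ← div_eq_mul_inv, inv_le_comm₀ hx0 (by positivity), inv_div,
      div_le_iff₀ hG0]
    linarith
  have hxδ : x ^ (-δ) ≤ G ^ δ * t ^ (-ε) := by
    calc x ^ (-δ) = (x⁻¹) ^ δ := by rw [Real.rpow_neg hx0.le, Real.inv_rpow hx0.le]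
      _ ≤ (G * t ^ (-φ)) ^ δ := by gcongr
      _ = G ^ δ * t ^ (-(φ * δ)) := by
        rw [Real.mul_rpow hG0.le (by positivity), ← Real.rpow_mul ht0.le, neg_mul]
      _ ≤ _ := by
        gcongr
        · exact min_le_left _ _
  have htx : t / x ≤ G * t ^ (-ε) := by
    calc t / x = t * x⁻¹ := div_eq_mul_inv _ _
      _ ≤ t * (G * t ^ (-φ)) := by gcongr
      _ = G * t ^ (-(φ - 1)) := by
        rw [show -(φ - 1) = 1 + -φ by ring, Real.rpow_add ht0, Real.rpow_one]; ring
      _ ≤ _ := by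
        gcongr
        · exact min_le_right _ _
  set V := |ξ ^ 3 + p * ξ ^ 2 + q * ξ + r| with hV
  have hVle : V ≤ K * t ^ (-φ - ε) := by
    have h1 : x * V ≤ (G ^ δ + 16 * C ^ 3 * G) * t ^ (-ε) := by
      calc _ ≤ _ := hval
        _ ≤ G ^ δ * t ^ (-ε) + 16 * C ^ 3 * (G * t ^ (-ε)) := by
          gcongr
          exact hdist.trans hxδ
        _ = _ := by ring
    calc V = x⁻¹ * (x * V) := by field_simp
      _ ≤ (G * t ^ (-φ)) * ((G ^ δ + 16 * C ^ 3 * G) * t ^ (-ε)) := by gcongr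
      _ = _ := by
        rw [show -φ - ε = -φ + -ε by ring, Real.rpow_add ht0 (-φ) (-ε), hK]; ring
  have hVK : V ≤ K := hVle.trans (mul_le_of_le_one_right hK0.le
    (Real.rpow_le_one_of_one_le_of_nonpos ht1 (by linarith)))
  have hr : |(r : ℝ)| ≤ K₁ / 12 * t := by
    have e : (r : ℝ) = (ξ ^ 3 + p * ξ ^ 2 + q * ξ + r) - (ξ ^ 3 + (p * ξ ^ 2 + q * ξ)) := by ring
    have h1 : |(r : ℝ)| ≤ V + (|ξ| ^ 3 + (|(p : ℝ)| * ξ ^ 2 + |(q : ℝ)| * |ξ|)) := by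
      rw [e]
      refine (abs_sub _ _).trans (add_le_add le_rfl ((abs_add_le _ _).trans ?_))
      rw [abs_pow]
      refine add_le_add le_rfl ((abs_add_le _ _).trans_eq ?_)
      rw [abs_mul, abs_mul, abs_of_nonneg (sq_nonneg ξ)]
    calc _ ≤ _ := h1
      _ ≤ K * t + (|ξ| ^ 3 * t + (8 * C ^ 2 * t * ξ ^ 2 + 8 * C ^ 2 * t * |ξ|)) := by
        gcongr
        · exact hVK.trans (le_mul_of_one_le_right hK0.le ht1)
        · exact le_mul_of_one_le_right (by positivity) ht1
      _ ≤ K₁ / 12 * t := by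
        rw [hK₁]
        have : 0 ≤ 8 * C ^ 2 * t := by positivity
        linarith
  have hpq : 8 * C ^ 2 * t ≤ K₁ / 12 * t := by
    gcongr
    rw [hK₁]
    have h1 : 0 ≤ 8 * C ^ 2 * (ξ ^ 2 + |ξ|) := by positivity
    have h2 : 0 ≤ |ξ| ^ 3 := by positivity
    linarith
  have hH1 : 1 ≤ K₁ / 12 * t := by
    refine le_trans ?_ hpq
    have : 1 ≤ C ^ 2 := one_le_pow₀ hC1
    nlinarith
  obtain ⟨α, hroot, hαV⟩ := exists_root_near p q r ξ
  obtain ⟨hint, hdeg, hheight⟩ := height_le_of_root hH1 (hp.trans hpq) (hq.trans hpq) hr hroot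
  have hdist : ‖(ξ : ℂ) - α‖ ≤ 12 * K * t ^ (-(φ ^ 2 + ε)) := by
    have h1 : ‖(ξ : ℂ) - α‖ * (t / 4) ≤ 3 * (K * t ^ (-φ - ε)) :=
      (mul_le_mul_of_nonneg_left hder (norm_nonneg _)).trans (hαV.trans (by gcongr))
    have h2 : t * t ^ (-(φ ^ 2 + ε)) = t ^ (-φ - ε) := by
      nth_rw 1 [← Real.rpow_one t]
      rw [← Real.rpow_add ht0, hφq]; congr 1; ring
    rw [← h2] at h1
    refine le_of_mul_le_mul_right (h1.trans_eq ?_) (by positivity : 0 < t / 4)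
    ring
  refine ⟨α, ⟨hint, hdeg, ?_⟩, ?_, ?_⟩
  · have hh0 : (0 : ℝ) < height α := by exact_mod_cast one_le_height hint
    have hhK : (height α : ℝ) ≤ K₁ * t := hheight.trans_eq (by ring)
    calc _ ≤ _ := hdist
      _ = 12 * K * K₁ ^ θ * (K₁ ^ (-θ) * t ^ (-(φ ^ 2 + ε))) := by
        rw [Real.rpow_neg hK₁0.le]; field_simp
      _ ≤ t ^ (ε / 2) * (K₁ ^ (-θ) * t ^ (-(φ ^ 2 + ε))) := by gcongr
      _ = (K₁ * t) ^ (-θ) := by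
        rw [Real.mul_rpow hK₁0.le ht0.le, mul_left_comm, ← Real.rpow_add ht0]
        congr 2; rw [hθ]; ring
      _ ≤ _ := Real.rpow_le_rpow_of_nonpos hh0 hhK (by linarith)
  · rintro rfl
    have h0 : ξ ^ 3 + p * ξ ^ 2 + q * ξ + r = 0 := by exact_mod_cast hroot
    linarith [hT p q r h0]
  · refine hdist.trans_lt ?_
    have h1 : t ^ (-(φ ^ 2 + ε)) ≤ t⁻¹ := by
      rw [← Real.rpow_neg_one]
      exact Real.rpow_le_rpow_of_exponent_le ht1 (by linarith)
    calc _ ≤ 12 * K * t⁻¹ := by gcongr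
      _ < ρ := by
        rw [div_lt_iff₀ hρ] at hkρ
        rw [← div_eq_mul_inv, div_lt_iff₀ ht0]
        linarith

theorem cubicApprox_iff (h : ApproxSeq ξ C u v w) : CubicApprox ξ ↔
    ∃ δ : ℝ, 0 < δ ∧ ∃ᶠ k in atTop, distInt (u k * ξ ^ 3) ≤ (u k : ℝ) ^ (-δ) :=
  ⟨h.frequently_distInt_le, fun ⟨_, hδ, hf⟩ => h.cubicApprox hδ hf⟩

end ApproxSeq

/-! ### Fibonacci products of matrices -/

/-- `ColComparable m X` says that the two entries of each column of `X` are within a factor `m` of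
each other. -/
def ColComparable (m : ℤ) (X : Matrix (Fin 2) (Fin 2) ℤ) : Prop :=
  ∀ j, X 0 j ≤ m * X 1 j ∧ X 1 j ≤ m * X 0 j

theorem mul_nonneg_entries {X Y : Matrix (Fin 2) (Fin 2) ℤ} (hX : ∀ i j, 0 ≤ X i j)
    (hY : ∀ i j, 0 ≤ Y i j) (i j : Fin 2) : 0 ≤ (X * Y) i j := by
  rw [Matrix.mul_apply]
  exact Finset.sum_nonneg fun k _ => mul_nonneg (hX i k) (hY k j)

theorem mul_pos_entries {X Y : Matrix (Fin 2) (Fin 2) ℤ} (hX : ∀ i j, 0 < X i j)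
    (hY : ∀ i j, 0 ≤ Y i j) (hdet : IsUnit Y.det) (i j : Fin 2) : 0 < (X * Y) i j := by
  rw [Matrix.mul_apply, Fin.sum_univ_two]
  have h0 := mul_nonneg (hX i 0).le (hY 0 j)
  have h1 := mul_nonneg (hX i 1).le (hY 1 j)
  refine (add_nonneg h0 h1).lt_of_ne' fun hsum => hdet.ne_zero ?_
  have e0 : Y 0 j = 0 :=
    (mul_eq_zero.mp (by linarith : X i 0 * Y 0 j = 0)).resolve_left (hX i 0).ne'
  have e1 : Y 1 j = 0 :=
    (mul_eq_zero.mp (by linarith : X i 1 * Y 1 j = 0)).resolve_left (hX i 1).ne'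
  rw [Matrix.det_fin_two]
  fin_cases j <;> simp_all

theorem ColComparable.mul {m : ℤ} {X Y : Matrix (Fin 2) (Fin 2) ℤ} (hX : ColComparable m X)
    (hY : ∀ i j, 0 ≤ Y i j) : ColComparable m (X * Y) := by
  intro j
  simp only [Matrix.mul_apply, Fin.sum_univ_two]
  constructor
  · nlinarith [mul_le_mul_of_nonneg_right (hX 0).1 (hY 0 j),
      mul_le_mul_of_nonneg_right (hX 1).1 (hY 1 j)]
  · nlinarith [mul_le_mul_of_nonneg_right (hX 0).2 (hY 0 j),
      mul_le_mul_of_nonneg_right (hX 1).2 (hY 1 j)]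

theorem J_mul_mul_J {Y : Matrix (Fin 2) (Fin 2) ℤ} (hY : Y.IsSymm) :
    J * Y * J = -Y.adjugate := by
  have h10 : Y 1 0 = Y 0 1 := hY.apply 0 1
  rw [Matrix.adjugate_fin_two]
  ext i j
  fin_cases i <;> fin_cases j <;>
    simp [J, Matrix.mul_apply, Matrix.vecMul, dotProduct, Fin.sum_univ_two, h10]

theorem bracket_eq {X Y : Matrix (Fin 2) (Fin 2) ℤ} (hY : Y.IsSymm) :
    bracket X X Y = X * Y.adjugate * X := by
  have : X * J * Y * J * X = X * (J * Y * J) * X := by simp only [Matrix.mul_assoc]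
  rw [bracket, this, J_mul_mul_J hY]
  simp

/-- The link between two consecutive palindromes: `B A` for even indices and `A B` for odd ones. -/
def link (A B : Matrix (Fin 2) (Fin 2) ℤ) (k : ℕ) : Matrix (Fin 2) (Fin 2) ℤ :=
  if Even k then B * A else A * B

/-- The palindromic prefixes `1, A, ABA, ABAABA, …` of the infinite Fibonacci word on `{A, B}`. The
point `y_k` is `± pal A B k`, and these matrices have non-negative coefficients. -/
def pal (A B : Matrix (Fin 2) (Fin 2) ℤ) : ℕ → Matrix (Fin 2) (Fin 2) ℤ
  | 0 => 1
  | 1 => A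
  | k + 2 => pal A B (k + 1) * link A B k * pal A B k

variable {A B : Matrix (Fin 2) (Fin 2) ℤ}

theorem link_add_two (k : ℕ) : link A B (k + 2) = link A B k := by
  simp [link, Nat.even_add]

theorem link_transpose (hA : A.IsSymm) (hB : B.IsSymm) (k : ℕ) :
    (link A B k).transpose = link A B (k + 1) := by
  unfold link
  by_cases h : Even k <;> simp [h, Nat.even_add_one, Matrix.transpose_mul, hA.eq, hB.eq]

theorem isUnit_det_link (hA : IsUnit A.det) (hB : IsUnit B.det) (k : ℕ) :
    IsUnit (link A B k).det := by
  unfold link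
  split_ifs <;> rw [Matrix.det_mul]
  exacts [hB.mul hA, hA.mul hB]

theorem isUnit_det_pal (hA : IsUnit A.det) (hB : IsUnit B.det) :
    ∀ k, IsUnit (pal A B k).det
  | 0 => by simp [pal]
  | 1 => hA
  | k + 2 => by
    rw [pal, Matrix.det_mul, Matrix.det_mul]
    exact ((isUnit_det_pal hA hB (k + 1)).mul (isUnit_det_link hA hB k)).mul
      (isUnit_det_pal hA hB k)

theorem Admissible.link_pos (h : Admissible A B) (k : ℕ) (i j : Fin 2) : 0 < link A B k i j := by
  unfold link
  split_ifs
  · have : B * A = (A * B).transpose := by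
      rw [Matrix.transpose_mul, h.symm_left.eq, h.symm_right.eq]
    rw [this]
    exact h.pos j i
  · exact h.pos i j

theorem Admissible.pal_nonneg (h : Admissible A B) : ∀ k i j, 0 ≤ pal A B k i j
  | 0, i, j => by
    rw [pal, Matrix.one_apply]
    split_ifs <;> norm_num
  | 1, i, j => h.nonneg i j
  | k + 2, i, j => mul_nonneg_entries (mul_nonneg_entries (h.pal_nonneg (k + 1))
      fun i j => (h.link_pos k i j).le) (h.pal_nonneg k) i j

/-- `y_k = ± pal A B k`. For `k ≥ 3` this holds because
`y_k = y_{k-1} adj(y_{k-3}) y_{k-1}` and, by symmetry, `pal (k - 1) = pal (k - 3) * _ * pal (k - 2)`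
begins with `pal (k - 3)`. -/
theorem exists_sign (h : Admissible A B) (k : ℕ) :
    ∃ s : ℤ, |s| = 1 ∧ point A B k = s • pal A B k := by
  induction k using Nat.strong_induction_on with
  | _ k ih =>
    match k, ih with
    | 0, _ => exact ⟨1, by simp, by simp [point, shifted, pal]⟩
    | 1, _ => exact ⟨1, by simp, by simp [point, shifted, pal]⟩
    | 2, _ =>
      have hBs : (B⁻¹).IsSymm := by
        rw [Matrix.IsSymm, Matrix.transpose_nonsing_inv, h.symm_right.eq]
      have hu : IsUnit (B⁻¹).det := Matrix.isUnit_nonsing_inv_det B h.unit_right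
      refine ⟨(B⁻¹).det, Int.isUnit_iff_abs_eq.mp hu, ?_⟩
      have hadj : (B⁻¹).adjugate = (B⁻¹).det • B := by
        calc (B⁻¹).adjugate = (B⁻¹).adjugate * (B⁻¹ * B) := by
              rw [Matrix.nonsing_inv_mul _ h.unit_right, mul_one]
          _ = _ := by rw [← mul_assoc, Matrix.adjugate_mul, smul_mul_assoc, one_mul]
      have : point A B 2 = bracket A A B⁻¹ := rfl
      have hp : pal A B 2 = A * B * A := by simp [pal, link, mul_assoc]
      rw [this, bracket_eq hBs, hadj, hp, mul_smul_comm, smul_mul_assoc]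
    | k + 3, ih =>
      obtain ⟨s, hs, es⟩ := ih k (by omega)
      obtain ⟨t, ht, et⟩ := ih (k + 2) (by omega)
      have hsymm : (point A B k).IsSymm := shifted_isSymm h.symm_left h.symm_right _
      have hunit : ∀ {s : ℤ}, |s| = 1 → s * s = 1 := fun {s} hs => by
        rw [← abs_mul_abs_self, hs, one_mul]
      have palSymm : ∀ {j : ℕ} {s : ℤ}, |s| = 1 → point A B j = s • pal A B j →
          (pal A B j).transpose = pal A B j := by
        intro j s hs e
        have h1 : pal A B j = s • point A B j := by rw [e, smul_smul, hunit hs, one_smul]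
        have h2 : (point A B j).transpose = point A B j :=
          shifted_isSymm h.symm_left h.symm_right _
        rw [h1, Matrix.transpose_smul, h2]
      obtain ⟨r, hr, er⟩ := ih (k + 1) (by omega)
      have hpal : pal A B (k + 2) = pal A B k * link A B (k + 1) * pal A B (k + 1) := by
        rw [← palSymm ht et, pal, Matrix.transpose_mul, Matrix.transpose_mul,
          palSymm hs es, palSymm hr er, link_transpose h.symm_left h.symm_right, mul_assoc]
      have hadj : (point A B k).adjugate * pal A B k = (s * (pal A B k).det) • 1 := by
        rw [es, Matrix.adjugate_smul, smul_mul_assoc, Matrix.adjugate_mul, smul_smul]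
        simp
      refine ⟨s * (pal A B k).det, ?_, ?_⟩
      · rw [abs_mul, hs, one_mul, Int.isUnit_iff_abs_eq.mp
          (isUnit_det_pal h.unit_left h.unit_right k)]
      · have e1 : point A B (k + 3) = bracket (point A B (k + 2)) (point A B (k + 2))
          (point A B k) := rfl
        rw [e1, bracket_eq hsymm, et]
        calc t • pal A B (k + 2) * (point A B k).adjugate * t • pal A B (k + 2)
            = (t * t) • (pal A B (k + 2) * ((point A B k).adjugate * pal A B (k + 2))) := by
              simp only [smul_mul_assoc, mul_smul_comm, smul_smul, mul_assoc]
          _ = pal A B (k + 2) * (((point A B k).adjugate * pal A B k) * link A B (k + 1) *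
                pal A B (k + 1)) := by
              rw [hunit ht, one_smul]
              conv_lhs => arg 2; rw [hpal]
              simp only [mul_assoc]
          _ = _ := by
              rw [hadj, pal.eq_3 A B (k + 1)]
              simp only [smul_mul_assoc, mul_smul_comm, one_mul, mul_assoc]

theorem pal_isSymm (h : Admissible A B) (k : ℕ) : (pal A B k).IsSymm := by
  obtain ⟨s, hs, e⟩ := exists_sign h k
  have h1 : pal A B k = s • point A B k := by
    rw [e, smul_smul, ← abs_mul_abs_self, hs, one_mul, one_smul]
  have h2 : (point A B k).IsSymm := shifted_isSymm h.symm_left h.symm_right _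
  rw [h1]
  exact h2.smul s

/-- Later palindromes begin with the earlier ones. -/
theorem exists_pal_eq_mul (h : Admissible A B) {j k : ℕ} (hj : 1 ≤ j) (hjk : j ≤ k) :
    ∃ N : Matrix (Fin 2) (Fin 2) ℤ, (∀ i j, 0 ≤ N i j) ∧ pal A B k = pal A B j * N := by
  induction k, hjk using Nat.le_induction with
  | base =>
    refine ⟨1, fun i j => ?_, (mul_one _).symm⟩
    rw [Matrix.one_apply]
    split_ifs <;> norm_num
  | succ k hk ih =>
    obtain ⟨N, hN, e⟩ := ih
    obtain ⟨k, rfl⟩ := Nat.exists_eq_add_of_le' (hj.trans hk)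
    refine ⟨N * (link A B k * pal A B k), mul_nonneg_entries hN
      (mul_nonneg_entries (fun i j => (h.link_pos k i j).le) (h.pal_nonneg k)), ?_⟩
    rw [pal, e]
    simp only [mul_assoc]

theorem Admissible.pal_pos (h : Admissible A B) {k : ℕ} (hk : 2 ≤ k) (i j : Fin 2) :
    0 < pal A B k i j := by
  obtain ⟨k, rfl⟩ := Nat.exists_eq_add_of_le' hk
  -- transposing reduces `X * link * Y` with `X` invertible to products starting with `link`
  have hX : ∀ i j, 0 < (pal A B (k + 1) * link A B k) i j := by
    intro i j
    have e : pal A B (k + 1) * link A B k =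
        (link A B (k + 1) * pal A B (k + 1)).transpose := by
      rw [Matrix.transpose_mul, (pal_isSymm h (k + 1)).eq,
        link_transpose h.symm_left h.symm_right, link_add_two]
    rw [e]
    exact mul_pos_entries (h.link_pos _) (h.pal_nonneg _)
      (isUnit_det_pal h.unit_left h.unit_right _) j i
  exact mul_pos_entries hX (h.pal_nonneg k) (isUnit_det_pal h.unit_left h.unit_right k) i j

theorem exists_colComparable {X : Matrix (Fin 2) (Fin 2) ℤ} (hX : ∀ i j, 0 < X i j) :
    ∃ m, 1 ≤ m ∧ ColComparable m X := by
  have h00 := hX 0 0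
  have h01 := hX 0 1
  have h10 := hX 1 0
  have h11 := hX 1 1
  refine ⟨X 0 0 + X 0 1 + X 1 0 + X 1 1, by omega, fun j => ?_⟩
  fin_cases j <;> constructor <;> simp only [Fin.zero_eta, Fin.mk_one] <;> nlinarith

/-- All palindromes from `ABA` on have comparable entries, since they begin with `ABA`. -/
theorem exists_colComparable_pal (h : Admissible A B) :
    ∃ m, 1 ≤ m ∧ (∀ i j, (A * B) i j ≤ m) ∧ ∀ k, 2 ≤ k → ColComparable m (pal A B k) := by
  obtain ⟨m, hm1, hm⟩ := exists_colComparable (h.pal_pos (k := 2) le_rfl)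
  set S := ∑ i, ∑ j, (A * B) i j with hS
  have hle : ∀ i j, (A * B) i j ≤ S := by
    intro i j
    have h00 := h.pos 0 0
    have h01 := h.pos 0 1
    have h10 := h.pos 1 0
    have h11 := h.pos 1 1
    rw [hS]
    simp only [Fin.sum_univ_two]
    fin_cases i <;> fin_cases j <;> simp only [Fin.zero_eta, Fin.mk_one] <;> omega
  refine ⟨m + S, ?_, fun i j => ?_, fun k hk => ?_⟩
  · linarith [hle 0 0, h.pos 0 0]
  · linarith [hle i j]
  · obtain ⟨N, hN, e⟩ := exists_pal_eq_mul h (j := 2) (by norm_num) hk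
    rw [e]
    refine ColComparable.mul (fun j => ?_) hN
    have hS0 : 0 < S := (h.pos 0 0).trans_le (hle 0 0)
    have h0 := mul_pos hS0 (h.pal_pos (k := 2) le_rfl 0 j)
    have h1 := mul_pos hS0 (h.pal_pos (k := 2) le_rfl 1 j)
    have := hm j
    constructor <;> linarith

/-- If `X` is symmetric of determinant `±1` with comparable entries, then all products `X N` with
`N` non-negative have almost the same slope as `X`. -/
theorem abs_slope_sub_le {m : ℤ} {X N : Matrix (Fin 2) (Fin 2) ℤ} (hX : ∀ i j, 0 < X i j)
    (hsymm : X.IsSymm) (hdet : IsUnit X.det) (hm : ColComparable m X) (hN : ∀ i j, 0 ≤ N i j)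
    (hpos : 0 < (X * N) 0 0) :
    |((X * N) 1 0 : ℝ) / ((X * N) 0 0 : ℝ) - (X 0 1 : ℝ) / (X 0 0 : ℝ)| ≤
      m / (X 0 0 : ℝ) ^ 2 := by
  have h10 : X 1 0 = X 0 1 := hsymm.apply 0 1
  have e : (X * N) 1 0 * X 0 0 - (X * N) 0 0 * X 0 1 = X.det * N 1 0 := by
    simp only [Matrix.mul_apply, Fin.sum_univ_two, Matrix.det_fin_two, h10]
    ring
  have hle : N 1 0 * X 0 0 ≤ m * (X * N) 0 0 := by
    have h1 := (hm 0).1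
    rw [h10] at h1
    have h2 : X 0 1 * N 1 0 ≤ (X * N) 0 0 := by
      simp only [Matrix.mul_apply, Fin.sum_univ_two]
      linarith [mul_nonneg (hX 0 0).le (hN 0 0)]
    have hm0 : 0 ≤ m := by
      by_contra hneg
      nlinarith [hX 0 0, hX 0 1]
    nlinarith [mul_le_mul_of_nonneg_right h1 (hN 1 0), mul_le_mul_of_nonneg_left h2 hm0]
  have habs : |(X * N) 1 0 * X 0 0 - (X * N) 0 0 * X 0 1| = N 1 0 := by
    rw [e, abs_mul, Int.isUnit_iff_abs_eq.mp hdet, one_mul, abs_of_nonneg (hN 1 0)]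
  have hx : (0 : ℝ) < X 0 0 := by exact_mod_cast hX 0 0
  have hy : (0 : ℝ) < (X * N) 0 0 := by exact_mod_cast hpos
  have habs' : |((X * N) 1 0 : ℝ) * X 0 0 - (X * N) 0 0 * X 0 1| = N 1 0 := by exact_mod_cast habs
  have hle' : (N 1 0 : ℝ) * X 0 0 ≤ m * (X * N) 0 0 := by exact_mod_cast hle
  rw [div_sub_div _ _ hy.ne' hx.ne', abs_div, habs', abs_of_pos (mul_pos hy hx),
    div_le_div_iff₀ (mul_pos hy hx) (pow_pos hx 2)]
  nlinarith [mul_le_mul_of_nonneg_right hle' hx.le]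

/-! ### The points `y_k` as an approximation sequence -/

/-- The determinant of three points of `ℤ³`, in the identification with symmetric matrices. -/
def det3 (X Y Z : Matrix (Fin 2) (Fin 2) ℤ) : ℤ :=
  X 0 0 * (Y 0 1 * Z 1 1 - Y 1 1 * Z 0 1) + X 0 1 * (Y 1 1 * Z 0 0 - Y 0 0 * Z 1 1) +
    X 1 1 * (Y 0 0 * Z 0 1 - Y 0 1 * Z 0 0)

/-- `[y, y, x] = ⟨y, x⟩ y - det(y) x`, so passing from `x, y', y` to `y', y, [y, y, x]` changes the
determinant by the factor `-det y`. -/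
theorem det3_bracket {X Y Z : Matrix (Fin 2) (Fin 2) ℤ} (hX : X.IsSymm) (hZ : Z.IsSymm) :
    det3 Y Z (bracket Z Z X) = -Z.det * det3 X Y Z := by
  have hX10 : X 1 0 = X 0 1 := hX.apply 0 1
  have hZ10 : Z 1 0 = Z 0 1 := hZ.apply 0 1
  rw [bracket_eq hX, Matrix.adjugate_fin_two, det3, det3, Matrix.det_fin_two]
  simp only [Matrix.mul_apply, Fin.sum_univ_two, Matrix.of_apply, Matrix.cons_val',
    Matrix.cons_val_zero, Matrix.cons_val_one, Matrix.cons_val_fin_one, hX10, hZ10]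
  ring

theorem det3_smul (r s t : ℤ) (X Y Z : Matrix (Fin 2) (Fin 2) ℤ) :
    det3 (r • X) (s • Y) (t • Z) = r * s * t * det3 X Y Z := by
  simp only [det3, Matrix.smul_apply, smul_eq_mul]
  ring

theorem isUnit_det_point (h : Admissible A B) (k : ℕ) : IsUnit (point A B k).det := by
  obtain ⟨s, hs, e⟩ := exists_sign h k
  rw [e, Matrix.det_smul]
  exact ((Int.isUnit_iff_abs_eq.mpr hs).pow _).mul (isUnit_det_pal h.unit_left h.unit_right k)

/-- Three consecutive points form a basis of `ℤ³`: for the initial points `B⁻¹, I, A` the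
determinant is `± trace(J A B)`. -/
theorem abs_det3_shifted (h : Admissible A B)
    (htr : (J * A * B).trace = 1 ∨ (J * A * B).trace = -1) (n : ℕ) :
    |det3 (shifted A B n) (shifted A B (n + 1)) (shifted A B (n + 2))| = 1 := by
  induction n with
  | zero =>
    have hA10 : A 1 0 = A 0 1 := h.symm_left.apply 0 1
    have hB10 : B 1 0 = B 0 1 := h.symm_right.apply 0 1
    have e : det3 (shifted A B 0) (shifted A B 1) (shifted A B 2) =
        Ring.inverse B.det * (J * A * B).trace := by
      simp only [shifted, Matrix.inv_def, det3, Matrix.adjugate_fin_two, Matrix.trace_fin_two,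
        Matrix.mul_apply, Fin.sum_univ_two, J, Matrix.smul_apply, Matrix.of_apply, Matrix.cons_val',
        Matrix.cons_val_zero, Matrix.cons_val_one, Matrix.cons_val_fin_one, smul_eq_mul,
        Matrix.one_apply, hA10, hB10]
      simp
      ring
    rw [e, abs_mul, Int.isUnit_iff_abs_eq.mp (isUnit_ringInverse.mpr h.unit_right), one_mul]
    rcases htr with htr | htr <;> simp [htr]
  | succ n ih =>
    have e : shifted A B (n + 1 + 2) =
        bracket (shifted A B (n + 2)) (shifted A B (n + 2)) (shifted A B n) := rfl
    rw [e, det3_bracket (shifted_isSymm h.symm_left h.symm_right _)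
      (shifted_isSymm h.symm_left h.symm_right _), abs_mul, ih, abs_neg, mul_one]
    exact Int.isUnit_iff_abs_eq.mp (isUnit_det_point h (n + 1))

theorem abs_det3_pal (h : Admissible A B)
    (htr : (J * A * B).trace = 1 ∨ (J * A * B).trace = -1) (k : ℕ) :
    |det3 (pal A B k) (pal A B (k + 1)) (pal A B (k + 2))| = 1 := by
  obtain ⟨r, hr, er⟩ := exists_sign h k
  obtain ⟨s, hs, es⟩ := exists_sign h (k + 1)
  obtain ⟨t, ht, et⟩ := exists_sign h (k + 2)
  have h1 := abs_det3_shifted h htr (k + 1)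
  change |det3 (point A B k) (point A B (k + 1)) (point A B (k + 2))| = 1 at h1
  rwa [er, es, et, det3_smul, abs_mul, abs_mul, abs_mul, hr, hs, ht, one_mul, one_mul, one_mul]
    at h1

theorem point_ratio (h : Admissible A B) (k : ℕ) :
    (point A B k 0 1 : ℝ) / (point A B k 0 0 : ℝ) = (pal A B k 0 1 : ℝ) / (pal A B k 0 0 : ℝ) := by
  obtain ⟨s, hs, e⟩ := exists_sign h k
  have hs0 : (s : ℝ) ≠ 0 := by
    rintro h0
    rw [Int.cast_eq_zero.mp h0] at hs
    simp at hs
  simp only [e, Matrix.smul_apply, smul_eq_mul, Int.cast_mul]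
  exact mul_div_mul_left _ _ hs0

theorem pal_two_mul_le (h : Admissible A B) {k : ℕ} (hk : 2 ≤ k) :
    2 * pal A B (k + 1) 0 0 ≤ pal A B (k + 2) 0 0 := by
  have h0 := fun i j => h.pal_pos hk i j
  have h1 := fun i j => h.pal_pos (hk.trans k.le_succ) i j
  have hl := h.link_pos k
  have hLz : ∀ i, 2 ≤ (link A B k * pal A B k) i 0 := by
    intro i
    rw [Matrix.mul_apply, Fin.sum_univ_two]
    have e0 := mul_pos (hl i 0) (h0 0 0)
    have e1 := mul_pos (hl i 1) (h0 1 0)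
    omega
  have e : pal A B (k + 2) = pal A B (k + 1) * (link A B k * pal A B k) := by rw [pal, mul_assoc]
  rw [e, Matrix.mul_apply, Fin.sum_univ_two]
  nlinarith [mul_le_mul_of_nonneg_left (hLz 0) (h1 0 0).le,
    mul_le_mul_of_nonneg_left (hLz 1) (h1 0 1).le, h1 0 1]

theorem pal_mul_le (h : Admissible A B) {k : ℕ} (hk : 2 ≤ k) :
    pal A B (k + 1) 0 0 * pal A B k 0 0 ≤ pal A B (k + 2) 0 0 := by
  have h0 := fun i j => h.pal_pos hk i j
  have h1 := fun i j => h.pal_pos (hk.trans k.le_succ) i j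
  have hl := h.link_pos k
  have hLz : pal A B k 0 0 ≤ (link A B k * pal A B k) 0 0 := by
    rw [Matrix.mul_apply, Fin.sum_univ_two]
    have e1 := mul_pos (hl 0 1) (h0 1 0)
    have e2 : 1 * pal A B k 0 0 ≤ link A B k 0 0 * pal A B k 0 0 :=
      mul_le_mul_of_nonneg_right (hl 0 0) (h0 0 0).le
    linarith
  have e : pal A B (k + 2) = pal A B (k + 1) * (link A B k * pal A B k) := by rw [pal, mul_assoc]
  rw [e, Matrix.mul_apply, Fin.sum_univ_two]
  have e3 : 0 ≤ pal A B (k + 1) 0 1 * (link A B k * pal A B k) 1 0 :=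
    mul_nonneg (h1 0 1).le (mul_nonneg_entries (fun i j => (hl i j).le) (h.pal_nonneg k) 1 0)
  linarith [mul_le_mul_of_nonneg_left hLz (h1 0 0).le]

theorem pal_le_mul (h : Admissible A B) {m : ℤ} (hm1 : 1 ≤ m) (hmAB : ∀ i j, (A * B) i j ≤ m)
    (hm : ∀ k, 2 ≤ k → ColComparable m (pal A B k)) {k : ℕ} (hk : 2 ≤ k) :
    pal A B (k + 2) 0 0 ≤ 4 * m ^ 3 * (pal A B (k + 1) 0 0 * pal A B k 0 0) := by
  have h0 := fun i j => h.pal_pos hk i j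
  have h1 := fun i j => h.pal_pos (hk.trans k.le_succ) i j
  have hl := h.link_pos k
  have hlm : ∀ i j, link A B k i j ≤ m := by
    intro i j
    unfold link
    split_ifs
    · have : B * A = (A * B).transpose := by
        rw [Matrix.transpose_mul, h.symm_left.eq, h.symm_right.eq]
      rw [this]
      exact hmAB j i
    · exact hmAB i j
  set Z := pal A B k
  set L := link A B k
  set X := pal A B (k + 1) with hX
  have hm0 : 0 ≤ m := by linarith
  have hZ : ∀ i, Z i 0 ≤ m * Z 0 0 := by
    intro i
    fin_cases i
    · exact le_mul_of_one_le_left (h0 0 0).le hm1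
    · exact (hm k hk 0).2
  have hX' : ∀ i, X 0 i ≤ m * X 0 0 := by
    intro i
    fin_cases i
    · exact le_mul_of_one_le_left (h1 0 0).le hm1
    · have e : X 1 0 = X 0 1 := (pal_isSymm h (k + 1)).apply 0 1
      exact e ▸ (hm (k + 1) (by omega) 0).2
  have hLZ : ∀ i, (L * Z) i 0 ≤ 2 * m ^ 2 * Z 0 0 := by
    intro i
    rw [Matrix.mul_apply, Fin.sum_univ_two]
    have e0 := mul_le_mul (hlm i 0) (hZ 0) (h0 0 0).le hm0
    have e1 := mul_le_mul (hlm i 1) (hZ 1) (h0 1 0).le hm0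
    linarith
  have hLZ0 : ∀ i, 0 ≤ (L * Z) i 0 := fun i =>
    mul_nonneg_entries (fun i j => (hl i j).le) (h.pal_nonneg k) i 0
  have e : pal A B (k + 2) = X * (L * Z) := by rw [pal, mul_assoc]
  rw [e, Matrix.mul_apply, Fin.sum_univ_two]
  have hmX : 0 ≤ m * X 0 0 := mul_nonneg hm0 (h1 0 0).le
  have e0 := mul_le_mul (hX' 0) (hLZ 0) (hLZ0 0) hmX
  have e1 := mul_le_mul (hX' 1) (hLZ 1) (hLZ0 1) hmX
  linarith

theorem abs_pal_slope_sub_le (h : Admissible A B) {m : ℤ} {k : ℕ} (hk : 2 ≤ k)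
    (hm : ColComparable m (pal A B k)) {N : Matrix (Fin 2) (Fin 2) ℤ} (hN : ∀ i j, 0 ≤ N i j)
    (hpos : 0 < (pal A B k * N) 0 0) :
    |((pal A B k * N) 1 0 : ℝ) / ((pal A B k * N) 0 0 : ℝ) -
      (pal A B k 0 1 : ℝ) / (pal A B k 0 0 : ℝ)| ≤ m / (pal A B k 0 0 : ℝ) ^ 2 :=
  abs_slope_sub_le (h.pal_pos hk) (pal_isSymm h k)
    (isUnit_det_pal h.unit_left h.unit_right k) hm hN hpos

theorem tendsto_pal (h : Admissible A B) :
    Tendsto (fun k => (pal A B (k + 3) 0 0 : ℝ)) atTop atTop :=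
  tendsto_atTop_of_two_mul_le (u := fun k => pal A B (k + 3) 0 0)
    (fun k => h.pal_pos (by omega) 0 0) fun k => pal_two_mul_le h (k := k + 2) (by omega)

theorem exists_approxSeq (h : Admissible A B)
    (htr : (J * A * B).trace = 1 ∨ (J * A * B).trace = -1) :
    ∃ ξ C : ℝ, IsLimit A B ξ ∧ ApproxSeq ξ C (fun k => pal A B (k + 3) 0 0)
      (fun k => pal A B (k + 3) 0 1) (fun k => pal A B (k + 3) 1 1) := by
  obtain ⟨m, hm1, hmAB, hm⟩ := exists_colComparable_pal h
  have hmR : (1 : ℝ) ≤ m := by exact_mod_cast hm1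
  set u : ℕ → ℤ := fun k => pal A B (k + 3) 0 0 with hu
  set v : ℕ → ℤ := fun k => pal A B (k + 3) 0 1 with hv
  set w : ℕ → ℤ := fun k => pal A B (k + 3) 1 1 with hw
  set r : ℕ → ℝ := fun k => (v k : ℝ) / u k with hr
  have hu1 : ∀ k, 1 ≤ u k := fun k => h.pal_pos (k := k + 3) (by omega) 0 0
  have hu2 : ∀ k, 2 * u k ≤ u (k + 1) := fun k => pal_two_mul_le h (k := k + 2) (by omega)
  have huR : ∀ k, (0 : ℝ) < u k := fun k => by exact_mod_cast hu1 k
  have hlim := tendsto_pal h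
  have hclose : ∀ k j, k ≤ j → |r j - r k| ≤ m / (u k : ℝ) ^ 2 := by
    intro k j hkj
    obtain ⟨N, hN, e⟩ := exists_pal_eq_mul h (j := k + 3) (k := j + 3) (by omega) (by omega)
    have hs : pal A B (j + 3) 1 0 = pal A B (j + 3) 0 1 := (pal_isSymm h (j + 3)).apply 0 1
    have := abs_pal_slope_sub_le h (k := k + 3) (by omega) (hm _ (by omega)) hN
      (e ▸ h.pal_pos (k := j + 3) (by omega) 0 0)
    rw [← e, hs] at this
    exact this
  have hb : Tendsto (fun k => (m : ℝ) / (u k : ℝ) ^ 2) atTop (𝓝 0) :=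
    ((tendsto_pow_atTop two_ne_zero).comp hlim).const_div_atTop _
  have hcauchy : CauchySeq r := by
    refine cauchySeq_of_le_tendsto_0' _ (fun k j hkj => ?_) hb
    rw [dist_comm, Real.dist_eq]
    exact hclose k j hkj
  obtain ⟨ξ, hξ⟩ := cauchySeq_tendsto_of_complete hcauchy
  have hclose' : ∀ k, |ξ - r k| ≤ m / (u k : ℝ) ^ 2 := fun k =>
    le_of_tendsto ((hξ.sub_const _).abs) (eventually_atTop.mpr ⟨k, hclose k⟩)
  have hv0 : ∀ k, 0 < v k := fun k => h.pal_pos (k := k + 3) (by omega) 0 1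
  have hr0 : ∀ k, 0 ≤ r k := fun k =>
    div_nonneg (by exact_mod_cast (hv0 k).le) (huR k).le
  have hrm : ∀ k, r k ≤ m := by
    intro k
    rw [hr]
    simp only
    rw [div_le_iff₀ (huR k)]
    have hs : pal A B (k + 3) 1 0 = pal A B (k + 3) 0 1 := (pal_isSymm h (k + 3)).apply 0 1
    have := (hm (k + 3) (by omega) 0).2
    rw [hs] at this
    exact_mod_cast this
  have hξ0 : 0 ≤ ξ := ge_of_tendsto' hξ hr0
  have hξm : ξ ≤ m := le_of_tendsto' hξ hrm
  have hdet : ∀ k, |u k * w k - v k ^ 2| = 1 := by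
    intro k
    have hs : pal A B (k + 3) 1 0 = pal A B (k + 3) 0 1 := (pal_isSymm h (k + 3)).apply 0 1
    have := Int.isUnit_iff_abs_eq.mp (isUnit_det_pal h.unit_left h.unit_right (k + 3))
    rwa [Matrix.det_fin_two, hs, ← sq] at this
  have happ1 : ∀ k, |(u k : ℝ) * ξ - v k| ≤ m / u k := by
    intro k
    have e : (u k : ℝ) * ξ - v k = u k * (ξ - r k) := by
      rw [hr]; field_simp [(huR k).ne']
    rw [e, abs_mul, abs_of_pos (huR k)]
    calc _ ≤ (u k : ℝ) * (m / (u k : ℝ) ^ 2) := by gcongr; exacts [(huR k).le, hclose' k]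
      _ = _ := by field_simp [(huR k).ne']
  have hm2 : (1 : ℝ) ≤ (m : ℝ) ^ 2 := one_le_pow₀ hmR
  have hm3 : (1 : ℝ) ≤ (m : ℝ) ^ 3 := one_le_pow₀ hmR
  have hmm : (m : ℝ) ≤ (m : ℝ) ^ 2 := le_self_pow₀ hmR two_ne_zero
  refine ⟨ξ, 4 * m ^ 3 + (2 * m ^ 2 + 1), ?_, ?_⟩
  · unfold IsLimit
    simp only [point_ratio h]
    exact (tendsto_add_atTop_iff_nat 3).mp hξ
  · refine ⟨by linarith, hu1, hu2, fun k => pal_mul_le h (k := k + 3) (by omega), fun k => ?_,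
      fun k => ?_, fun k => ?_, hdet, fun k => abs_det3_pal h htr (k + 3)⟩
    · have h1 : u (k + 2) ≤ 4 * m ^ 3 * (u (k + 1) * u k) :=
        pal_le_mul h hm1 hmAB hm (k := k + 3) (by omega)
      have h2 : (u (k + 2) : ℝ) ≤ 4 * m ^ 3 * (u (k + 1) * u k) := by exact_mod_cast h1
      have h3 := mul_pos (huR (k + 1)) (huR k)
      refine h2.trans ?_
      gcongr
      linarith
    · refine (happ1 k).trans ?_
      gcongr
      · exact (huR k).le
      · linarith
    · have hdk : |(u k : ℝ) * w k - v k ^ 2| = 1 := by exact_mod_cast hdet k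
      have e : (u k : ℝ) * ξ ^ 2 - w k =
          (u k * ξ - v k) * (ξ + r k) - (u k * w k - v k ^ 2) / u k := by
        have := (huR k).ne'
        rw [hr]; field_simp; ring
      rw [e]
      refine (abs_sub _ _).trans ?_
      rw [abs_mul, abs_div, hdk, abs_of_pos (huR k), abs_of_nonneg (add_nonneg hξ0 (hr0 k))]
      have hmu : 0 ≤ (m : ℝ) / u k := div_nonneg (by linarith) (huR k).le
      calc _ ≤ (m : ℝ) / u k * (m + m) + 1 / u k :=
            add_le_add (mul_le_mul (happ1 k) (add_le_add hξm (hrm k))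
              (add_nonneg hξ0 (hr0 k)) hmu) le_rfl
        _ = (2 * (m : ℝ) ^ 2 + 1) / u k := by ring
        _ ≤ _ := div_le_div_of_nonneg_right (by linarith) (huR k).le

theorem frequently_atTop_add (n : ℕ) {p : ℕ → Prop} :
    (∃ᶠ k in atTop, p (k + n)) ↔ ∃ᶠ k in atTop, p k := by
  conv_rhs => rw [← map_add_atTop_eq_nat n, frequently_map]

theorem distInt_neg (x : ℝ) : distInt (-x) = distInt x := by
  have key : ∀ y : ℝ, distInt (-y) ≤ distInt y := by
    intro y
    refine (distInt_le _ (-round y)).trans_eq ?_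
    rw [distInt, ← abs_neg]
    congr 1
    push_cast; ring
  exact le_antisymm (key x) (by simpa using key (-x))

theorem norm_smul_of_abs_eq_one {s : ℤ} (hs : |s| = 1) (X : Matrix (Fin 2) (Fin 2) ℤ) :
    norm (s • X) = norm X := by
  simp only [norm, Matrix.smul_apply, smul_eq_mul, abs_mul, hs, one_mul]

/-- In the condition `{y_{k,0} ξ³} ≤ Y_k ^ (-δ)` the norm may be replaced by the comparable
quantity `|y_{k,0}|`, at the cost of changing `δ`. -/
theorem smallCube_iff (h : Admissible A B) (ξ : ℝ) : SmallCube A B ξ ↔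
    ∃ δ : ℝ, 0 < δ ∧ ∃ᶠ k in atTop, distInt ((pal A B (k + 3) 0 0 : ℝ) * ξ ^ 3) ≤
      (pal A B (k + 3) 0 0 : ℝ) ^ (-δ) := by
  obtain ⟨m, hm1, -, hm⟩ := exists_colComparable_pal h
  have hshift : SmallCube A B ξ ↔ ∃ δ : ℝ, 0 < δ ∧ ∃ᶠ k in atTop,
      distInt ((pal A B (k + 3) 0 0 : ℝ) * ξ ^ 3) ≤ (norm (pal A B (k + 3)) : ℝ) ^ (-δ) := by
    refine exists_congr fun δ => and_congr_right fun _ => ?_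
    refine Nat.frequently_atTop_iff_infinite.symm.trans ((frequently_atTop_add 3).symm.trans ?_)
    refine frequently_congr (Eventually.of_forall fun k => ?_)
    obtain ⟨s, hs, e⟩ := exists_sign h (k + 3)
    rw [e, norm_smul_of_abs_eq_one hs, Matrix.smul_apply, smul_eq_mul]
    rcases eq_or_eq_neg_of_abs_eq hs with rfl | rfl
    · simp
    · simp [distInt_neg]
  rw [hshift]
  have hu1 : ∀ k, 1 ≤ pal A B (k + 3) 0 0 := fun k => h.pal_pos (by omega) 0 0
  have hlow : ∀ k, pal A B (k + 3) 0 0 ≤ norm (pal A B (k + 3)) := fun k =>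
    (le_abs_self _).trans (le_max_left _ _)
  have hup : ∀ k, norm (pal A B (k + 3)) ≤ m ^ 2 * pal A B (k + 3) 0 0 := by
    intro k
    have hs : pal A B (k + 3) 1 0 = pal A B (k + 3) 0 1 := (pal_isSymm h (k + 3)).apply 0 1
    have h0 := (hm (k + 3) (by omega) 0).2
    have h1 := (hm (k + 3) (by omega) 1).2
    rw [hs] at h0
    have hp := fun i j => h.pal_pos (k := k + 3) (by omega) i j
    have hm2 : m ≤ m ^ 2 := le_self_pow₀ hm1 two_ne_zero
    have h2 : m * pal A B (k + 3) 0 0 ≤ m ^ 2 * pal A B (k + 3) 0 0 :=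
      mul_le_mul_of_nonneg_right hm2 (hp 0 0).le
    have h3 := mul_le_mul_of_nonneg_left h0 (zero_le_one.trans hm1)
    have h4 : 1 * pal A B (k + 3) 0 0 ≤ m * pal A B (k + 3) 0 0 :=
      mul_le_mul_of_nonneg_right hm1 (hp 0 0).le
    unfold norm
    rw [abs_of_pos (hp 0 0), abs_of_pos (hp 0 1), abs_of_pos (hp 1 1)]
    refine max_le (by linarith) (max_le (by linarith) (by linarith))
  constructor
  · rintro ⟨δ, hδ, hf⟩
    refine ⟨δ, hδ, hf.mono fun k hk => hk.trans ?_⟩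
    exact Real.rpow_le_rpow_of_nonpos (by exact_mod_cast hu1 k) (by exact_mod_cast hlow k)
      (by linarith)
  · rintro ⟨δ, hδ, hf⟩
    refine ⟨δ / 2, half_pos hδ, ?_⟩
    refine (hf.and_eventually ((tendsto_pal h).eventually_ge_atTop ((m : ℝ) ^ 2))).mono ?_
    rintro k ⟨hk, hkm⟩
    refine hk.trans ?_
    have hu0 : (0 : ℝ) < pal A B (k + 3) 0 0 := by exact_mod_cast hu1 k
    have hn0 : (0 : ℝ) < norm (pal A B (k + 3)) := hu0.trans_le (by exact_mod_cast hlow k)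
    have hle : (norm (pal A B (k + 3)) : ℝ) ≤ (pal A B (k + 3) 0 0 : ℝ) ^ (2 : ℝ) := by
      have h1 : (norm (pal A B (k + 3)) : ℝ) ≤ (m : ℝ) ^ 2 * pal A B (k + 3) 0 0 := by
        exact_mod_cast hup k
      rw [Real.rpow_two]
      nlinarith
    calc (pal A B (k + 3) 0 0 : ℝ) ^ (-δ) = ((pal A B (k + 3) 0 0 : ℝ) ^ (2 : ℝ)) ^ (-(δ / 2)) := by
          rw [← Real.rpow_mul hu0.le]; congr 1; ring
      _ ≤ _ := Real.rpow_le_rpow_of_nonpos hn0 hle (by linarith)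

theorem exists_limit_and_iff (h : Admissible A B)
    (htr : (J * A * B).trace = 1 ∨ (J * A * B).trace = -1) :
    ∃ ξ : ℝ, IsLimit A B ξ ∧ (CubicApprox ξ ↔ SmallCube A B ξ) := by
  obtain ⟨ξ, C, hlim, happ⟩ := exists_approxSeq h htr
  exact ⟨ξ, hlim, happ.cubicApprox_iff.trans (smallCube_iff h ξ).symm⟩

/-! ### The Fibonacci continued fraction -/

/-- The product of the matrices `(c 1; 1 0)` over the letters `c` of a word, which computes the
continuants of the word. -/
def letterProd (l : List ℕ) : Matrix (Fin 2) (Fin 2) ℤ :=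
  (l.map fun c : ℕ => !![(c : ℤ), 1; 1, 0]).prod

theorem letterProd_append (l l' : List ℕ) :
    letterProd (l ++ l') = letterProd l * letterProd l' := by
  simp [letterProd]

theorem letterProd_nonneg (l : List ℕ) (i j : Fin 2) : 0 ≤ letterProd l i j := by
  induction l generalizing i j with
  | nil =>
    rw [letterProd, List.map_nil, List.prod_nil, Matrix.one_apply]
    split_ifs <;> norm_num
  | cons c l ih =>
    have e : letterProd (c :: l) = !![(c : ℤ), 1; 1, 0] * letterProd l := by simp [letterProd]
    rw [e]
    refine mul_nonneg_entries (fun i j => ?_) ih i j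
    fin_cases i <;> fin_cases j <;> simp

theorem isUnit_det_letterProd (l : List ℕ) : IsUnit (letterProd l).det := by
  induction l with
  | nil => simp [letterProd]
  | cons c l ih =>
    have e : letterProd (c :: l) = !![(c : ℤ), 1; 1, 0] * letterProd l := by simp [letterProd]
    rw [e, Matrix.det_mul]
    refine IsUnit.mul ?_ ih
    simp [Matrix.det_fin_two]

/-- The Fibonacci words are the palindromic prefixes followed by two more letters. -/
theorem letterProd_fibWord (a b : ℕ) : ∀ k, letterProd (fibWord a b (k + 2)) =
    pal !![(a : ℤ), 1; 1, 0] !![(b : ℤ), 1; 1, 0] k *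
      link !![(a : ℤ), 1; 1, 0] !![(b : ℤ), 1; 1, 0] (k + 1)
  | 0 => by simp [fibWord, letterProd, pal, link]
  | 1 => by simp [fibWord, letterProd, pal, link]
  | k + 2 => by
    rw [show fibWord a b (k + 2 + 2) = fibWord a b (k + 1 + 2) ++ fibWord a b (k + 2) from rfl,
      letterProd_append, letterProd_fibWord a b (k + 1), letterProd_fibWord a b k,
      show k + 1 + 1 = k + 2 from rfl, show k + 2 + 1 = k + 1 + 2 from rfl, link_add_two,
      link_add_two, pal]
    simp only [mul_assoc]

theorem lt_length_fibWord (a b : ℕ) : ∀ n, n < (fibWord a b (n + 1)).length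
  | 0 => by simp [fibWord]
  | 1 => by simp [fibWord]
  | n + 2 => by
    have h1 := lt_length_fibWord a b (n + 1)
    have h2 := lt_length_fibWord a b n
    rw [show fibWord a b (n + 2 + 1) = fibWord a b (n + 1 + 1) ++ fibWord a b (n + 1) from rfl,
      List.length_append]
    omega

theorem fibWord_prefix (a b : ℕ) {j k : ℕ} (hjk : j ≤ k) :
    fibWord a b (j + 1) <+: fibWord a b (k + 1) := by
  induction k, hjk using Nat.le_induction with
  | base => exact List.prefix_rfl
  | succ k _ ih => exact ih.trans (List.prefix_append _ _)

theorem getD_eq_of_prefix {l l' : List ℕ} (h : l <+: l') {i : ℕ} (hi : i < l.length) :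
    l.getD i 0 = l'.getD i 0 := by
  obtain ⟨t, rfl⟩ := h
  rw [List.getD_append _ _ _ _ hi]

theorem fibWord_eq_map (a b k : ℕ) : fibWord a b (k + 1) =
    (List.range (fibWord a b (k + 1)).length).map (fibLetter a b) := by
  refine List.ext_getElem (by simp) fun i hi _ => ?_
  rw [List.getElem_map, List.getElem_range, ← List.getD_eq_getElem _ 0 hi, fibLetter]
  rcases le_total k (i + 1) with hk | hk
  · exact getD_eq_of_prefix (fibWord_prefix a b hk) hi
  · exact (getD_eq_of_prefix (fibWord_prefix a b hk)
      (i.lt_succ_self.trans (lt_length_fibWord a b (i + 1)))).symm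

/-- The product over the first `n` letters of the infinite Fibonacci word. -/
def initProd (a b n : ℕ) : Matrix (Fin 2) (Fin 2) ℤ :=
  letterProd ((List.range n).map (fibLetter a b))

theorem initProd_succ (a b n : ℕ) :
    initProd a b (n + 1) = initProd a b n * !![(fibLetter a b n : ℤ), 1; 1, 0] := by
  simp [initProd, List.range_succ, letterProd]

/-- The continuants of the continued fraction are the entries of `initProd`. -/
theorem contsAux_fibContFract (a b n : ℕ) :
    (fibContFract a b).contsAux n = ⟨(initProd a b n 1 1 : ℝ), (initProd a b n 0 1 : ℝ)⟩ ∧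
    (fibContFract a b).contsAux (n + 1) =
      ⟨(initProd a b n 1 0 : ℝ), (initProd a b n 0 0 : ℝ)⟩ := by
  induction n with
  | zero => simp [initProd, letterProd, GenContFract.contsAux, fibContFract]
  | succ n ih =>
    have hs : (fibContFract a b).s.get? n = some ⟨1, (fibLetter a b n : ℝ)⟩ := rfl
    have h2 := GenContFract.contsAux_recurrence hs ih.1 ih.2
    rw [h2, ih.2, initProd_succ]
    simp [Matrix.mul_apply, Fin.sum_univ_two, mul_comm]

theorem convs_fibContFract (a b n : ℕ) : (fibContFract a b).convs n =
    (initProd a b n 1 0 : ℝ) / (initProd a b n 0 0 : ℝ) := by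
  rw [GenContFract.conv_eq_conts_a_div_conts_b, GenContFract.nth_cont_eq_succ_nth_contAux,
    (contsAux_fibContFract a b n).2]

theorem admissible_fib {a b : ℕ} (ha : 0 < a) (hb : 0 < b) (hab : a ≠ b) :
    Admissible !![(a : ℤ), 1; 1, 0] !![(b : ℤ), 1; 1, 0] where
  symm_left := by ext i j; fin_cases i <;> fin_cases j <;> rfl
  symm_right := by ext i j; fin_cases i <;> fin_cases j <;> rfl
  unit_left := by simp [Matrix.det_fin_two]
  unit_right := by simp [Matrix.det_fin_two]
  not_comm h := by
    have := congrFun (congrFun h 0) 1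
    simp [Matrix.mul_apply, Fin.sum_univ_two] at this
    exact hab this
  nonneg i j := by fin_cases i <;> fin_cases j <;> simp
  pos i j := by
    have : (0 : ℤ) < a * b + 1 := by positivity
    fin_cases i <;> fin_cases j <;> simp [ha, hb, this]

theorem trace_fib (a b : ℕ) :
    (J * !![(a : ℤ), 1; 1, 0] * !![(b : ℤ), 1; 1, 0]).trace = b - a := by
  simp [J, Matrix.trace_fin_two]
  ring

/-- The convergents tend to the limit of the ratios `y_{k,1} / y_{k,0}`: the product over the first
`n` letters begins with `pal k` as soon as `n` is at least the length of the Fibonacci word of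
index `k + 2`, so its slope is close to that of `pal k`. -/
theorem tendsto_convs {a b : ℕ} (ha : 0 < a) (hb : 0 < b) (hab : a ≠ b) {ξ : ℝ}
    (hξ : IsLimit !![(a : ℤ), 1; 1, 0] !![(b : ℤ), 1; 1, 0] ξ) :
    Tendsto (fibContFract a b).convs atTop (𝓝 ξ) := by
  have h := admissible_fib ha hb hab
  set A : Matrix (Fin 2) (Fin 2) ℤ := !![(a : ℤ), 1; 1, 0] with hA
  set B : Matrix (Fin 2) (Fin 2) ℤ := !![(b : ℤ), 1; 1, 0] with hB
  obtain ⟨m, -, -, hm⟩ := exists_colComparable_pal h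
  have hclose : ∀ k, 2 ≤ k → ∀ n, (fibWord a b (k + 2)).length ≤ n →
      |(fibContFract a b).convs n - (pal A B k 0 1 : ℝ) / (pal A B k 0 0 : ℝ)| ≤
        m / (pal A B k 0 0 : ℝ) ^ 2 := by
    intro k hk n hn
    obtain ⟨d, rfl⟩ := Nat.exists_eq_add_of_le hn
    obtain ⟨l, hl⟩ : ∃ l, initProd a b ((fibWord a b (k + 2)).length + d) =
        letterProd (fibWord a b (k + 2)) * letterProd l := by
      refine ⟨((List.range d).map ((fibWord a b (k + 2)).length + ·)).map (fibLetter a b), ?_⟩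
      rw [initProd, List.range_add, List.map_append, letterProd_append, ← fibWord_eq_map]
    rw [letterProd_fibWord, ← hA, ← hB, mul_assoc] at hl
    have hN : ∀ i j, 0 ≤ (link A B (k + 1) * letterProd l) i j :=
      mul_nonneg_entries (fun i j => (h.link_pos _ i j).le) (letterProd_nonneg l)
    have hdet : IsUnit (link A B (k + 1) * letterProd l).det := by
      rw [Matrix.det_mul]
      exact (isUnit_det_link h.unit_left h.unit_right _).mul (isUnit_det_letterProd l)
    have := abs_pal_slope_sub_le h hk (hm k hk) hN
      (mul_pos_entries (h.pal_pos hk) hN hdet 0 0)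
    rwa [← hl, ← convs_fibContFract] at this
  have hlim : Tendsto (fun k => (pal A B (k + 3) 0 1 : ℝ) / (pal A B (k + 3) 0 0 : ℝ)) atTop
      (𝓝 ξ) := by
    unfold IsLimit at hξ
    simp only [point_ratio h] at hξ
    exact (tendsto_add_atTop_iff_nat 3).mpr hξ
  have hb0 : Tendsto (fun k => (m : ℝ) / (pal A B (k + 3) 0 0 : ℝ) ^ 2) atTop (𝓝 0) :=
    ((tendsto_pow_atTop two_ne_zero).comp (tendsto_pal h)).const_div_atTop _
  refine Metric.tendsto_atTop.mpr fun ε hε => ?_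
  obtain ⟨k, hk1, hk2⟩ := ((hlim.eventually (Metric.ball_mem_nhds ξ (half_pos hε))).and
    (hb0.eventually (gt_mem_nhds (half_pos hε)))).exists
  refine ⟨(fibWord a b (k + 3 + 2)).length, fun n hn => ?_⟩
  have h1 := hclose (k + 3) (by omega) n hn
  rw [← Real.dist_eq] at h1
  linarith [dist_triangle ((fibContFract a b).convs n)
    ((pal A B (k + 3) 0 1 : ℝ) / (pal A B (k + 3) 0 0 : ℝ)) ξ]

end Roy

theorem corollary10p2 :
    (∀ A B : Matrix (Fin 2) (Fin 2) ℤ, Roy.Admissible A B →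
      ((Roy.J * A * B).trace = 1 ∨ (Roy.J * A * B).trace = -1) →
      ∃ ξ : ℝ, Roy.IsLimit A B ξ ∧ (Roy.CubicApprox ξ ↔ Roy.SmallCube A B ξ)) ∧
    (∀ a b : ℕ, 0 < a → 0 < b → |(a : ℤ) - (b : ℤ)| = 1 →
      ∀ A B : Matrix (Fin 2) (Fin 2) ℤ, A = !![(a : ℤ), 1; 1, 0] → B = !![(b : ℤ), 1; 1, 0] →
      Roy.Admissible A B ∧
      ((Roy.J * A * B).trace = 1 ∨ (Roy.J * A * B).trace = -1) ∧
      ∃ ξ : ℝ, Tendsto (Roy.fibContFract a b).convs atTop (𝓝 ξ) ∧ Roy.IsLimit A B ξ ∧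
        (Roy.CubicApprox ξ ↔ Roy.SmallCube A B ξ)) := by
  refine ⟨fun A B h htr => Roy.exists_limit_and_iff h htr, ?_⟩
  rintro a b ha hb hab A B rfl rfl
  have hne : a ≠ b := by
    rintro rfl
    simp at hab
  have h := Roy.admissible_fib ha hb hne
  have htr : (Roy.J * !![(a : ℤ), 1; 1, 0] * !![(b : ℤ), 1; 1, 0]).trace = 1 ∨
      (Roy.J * !![(a : ℤ), 1; 1, 0] * !![(b : ℤ), 1; 1, 0]).trace = -1 := by
    rw [Roy.trace_fib]
    rcases eq_or_eq_neg_of_abs_eq hab with h1 | h1 <;> omega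
  obtain ⟨ξ, hξ, hiff⟩ := Roy.exists_limit_and_iff h htr
  exact ⟨h, htr, ξ, Roy.tendsto_convs ha hb hne hξ, hξ, hiff⟩
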